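/- Let $(R,\mathfrak m,k)$ be a Noetherian local ring and $M$ a finitely generated $R$-module. Let $G_{\mathfrak m}(R)=\bigoplus_{i\ge 0}\mathfrak m^i/\mathfrak m^{i+1}$ be the associated graded ring of $R$, and $G_{\mathfrak m}(M)=\bigoplus_{i\ge 0}\mathfrak m^iM/\mathfrak m^{i+1}M$ the associated graded module of $M$, a graded $G_{\mathfrak m}(R)$-module. A finitely generated graded module $N$ over $A=G_{\mathfrak m}(R)$ has a \emph{linear resolution} if there is an integer $\delta_0$ such that, for every $i\ge 0$, all basis elements of the $i$-th free module in a minimal graded free resolution of $N$ over $A$ have degree $\delta_0+i$; and $A$ is \emph{Koszul} if the graded module $k=A/A_+$ has a linear resolution over $A$, where $A_+=\bigoplus_{i\ge1}\mathfrak m^i/\mathfrak m^{i+1}$. The \emph{Poincaré series} of $M$ is $P^R_M(z)=\sum_{i\ge 0}\beta_i(M)z^i\in\mathbb Z[[z]]$, where $\beta_i(M)$ is the rank of the $i$-th free module in a minimal free resolution of $M$ over $R$. If $G_{\mathfrak m}(M)$ has a linear resolution over $G_{\mathfrak m}(R)$, then $P^R_M(z)$ is rational, i.e. there are polynomials $f,g\in\mathbb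 Z[z]$ with $g\neq 0$ and $g(z)P^R_M(z)=f(z)$. In particular, if $G_{\mathfrak m}(R)$ is Koszul, then $P^R_k(z)$ is rational. -/

import Mathlib

open scoped DirectSum

universe u v

/-! ## The associated graded ring and the associated graded module -/

namespace AssocGraded

noncomputable section

variable {R : Type u} [CommRing R] (I : Ideal R) (M : Type v) [AddCommGroup M] [Module R M]

/-- The `i`-th piece `I ^ i / I ^ (i + 1)` of the associated graded ring of `R`. -/
abbrev RingPiece (i : ℕ) : Type u :=
  ↥(I ^ i) ⧸ Submodule.submoduleOf (I ^ (i + 1)) (I ^ i)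

/-- The `i`-th piece `I ^ i M / I ^ (i + 1) M` of the associated graded module of `M`. -/
abbrev ModPiece (i : ℕ) : Type v :=
  ↥(I ^ i • (⊤ : Submodule R M)) ⧸
    Submodule.submoduleOf (I ^ (i + 1) • (⊤ : Submodule R M)) (I ^ i • (⊤ : Submodule R M))

variable {I} in
/-- The class of `a ∈ I ^ i` in `I ^ i / I ^ (i + 1)`. -/
def ringMk (i : ℕ) (a : R) (ha : a ∈ I ^ i) : RingPiece I i :=
  Submodule.Quotient.mk ⟨a, ha⟩

variable {I M} in
/-- The class of `x ∈ I ^ i M` in `I ^ i M / I ^ (i + 1) M`. -/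
def modMk (i : ℕ) (x : M) (hx : x ∈ I ^ i • (⊤ : Submodule R M)) : ModPiece I M i :=
  Submodule.Quotient.mk ⟨x, hx⟩

variable {I M}

theorem ringMk_eq_zero {i : ℕ} {a : R} (ha : a ∈ I ^ i) (h : a ∈ I ^ (i + 1)) :
    ringMk i a ha = 0 :=
  (Submodule.Quotient.mk_eq_zero _).2 h

theorem modMk_eq_zero {i : ℕ} {x : M} (hx : x ∈ I ^ i • (⊤ : Submodule R M))
    (h : x ∈ I ^ (i + 1) • (⊤ : Submodule R M)) : modMk i x hx = 0 :=
  (Submodule.Quotient.mk_eq_zero _).2 h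

theorem ringPiece_ind {i : ℕ} {P : RingPiece I i → Prop}
    (h : ∀ a ha, P (ringMk i a ha)) (x : RingPiece I i) : P x := by
  induction x using Submodule.Quotient.induction_on with
  | _ a => exact h a.1 a.2

theorem modPiece_ind {i : ℕ} {P : ModPiece I M i → Prop}
    (h : ∀ x hx, P (modMk i x hx)) (x : ModPiece I M i) : P x := by
  induction x using Submodule.Quotient.induction_on with
  | _ a => exact h a.1 a.2

theorem mul_mem_pow {i j : ℕ} {a b : R} (ha : a ∈ I ^ i) (hb : b ∈ I ^ j) :
    a * b ∈ I ^ (i + j) := by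
  rw [pow_add]; exact Ideal.mul_mem_mul ha hb

theorem smul_mem_pow {i j : ℕ} {a : R} {x : M} (ha : a ∈ I ^ i)
    (hx : x ∈ I ^ j • (⊤ : Submodule R M)) : a • x ∈ I ^ (i + j) • (⊤ : Submodule R M) := by
  rw [pow_add, Submodule.mul_smul]; exact Submodule.smul_mem_smul ha hx

variable (I M)

/-- The multiplication `I ^ i / I ^ (i + 1) × I ^ j / I ^ (j + 1) → I ^ (i + j) / I ^ (i + j + 1)`,
induced by the multiplication of `R`. -/
def mulHom (i j : ℕ) : RingPiece I i →ₗ[R] RingPiece I j →ₗ[R] RingPiece I (i + j) :=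
  LinearMap.flip <| Submodule.liftQ _
    (LinearMap.flip <| Submodule.liftQ _
      (LinearMap.mk₂ R
        (fun (a : ↥(I ^ i)) (b : ↥(I ^ j)) => ringMk (i + j) (a.1 * b.1) (mul_mem_pow a.2 b.2))
        (fun _ _ _ => congrArg Submodule.Quotient.mk (Subtype.ext (add_mul _ _ _)))
        (fun _ _ _ => congrArg Submodule.Quotient.mk (Subtype.ext (smul_mul_assoc _ _ _)))
        (fun _ _ _ => congrArg Submodule.Quotient.mk (Subtype.ext (mul_add _ _ _)))
        (fun _ _ _ => congrArg Submodule.Quotient.mk (Subtype.ext (mul_smul_comm _ _ _))))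
      (by
        intro a ha
        replace ha := Submodule.mem_comap.1 ha
        rw [LinearMap.mem_ker]
        ext b
        refine ringMk_eq_zero _ ?_
        have := mul_mem_pow ha b.2
        rwa [add_right_comm] at this))
    (by
      intro b hb
      replace hb := Submodule.mem_comap.1 hb
      rw [LinearMap.mem_ker]
      ext a
      exact ringMk_eq_zero (mul_mem_pow a.2 b.2) (mul_mem_pow (j := j + 1) a.2 hb))

/-- The scalar multiplication
`I ^ i / I ^ (i + 1) × I ^ j M / I ^ (j + 1) M → I ^ (i + j) M / I ^ (i + j + 1) M`,
induced by the scalar multiplication of `R` on `M`. -/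
def smulHom (i j : ℕ) : RingPiece I i →ₗ[R] ModPiece I M j →ₗ[R] ModPiece I M (i + j) :=
  LinearMap.flip <| Submodule.liftQ _
    (LinearMap.flip <| Submodule.liftQ _
      (LinearMap.mk₂ R
        (fun (a : ↥(I ^ i)) (x : ↥(I ^ j • (⊤ : Submodule R M))) =>
          modMk (i + j) (a.1 • x.1) (smul_mem_pow a.2 x.2))
        (fun _ _ _ => congrArg Submodule.Quotient.mk (Subtype.ext (add_smul _ _ _)))
        (fun _ _ _ => congrArg Submodule.Quotient.mk (Subtype.ext (smul_assoc _ _ _)))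
        (fun _ _ _ => congrArg Submodule.Quotient.mk (Subtype.ext (smul_add _ _ _)))
        (fun _ _ _ => congrArg Submodule.Quotient.mk (Subtype.ext (smul_comm _ _ _))))
      (by
        intro a ha
        replace ha := Submodule.mem_comap.1 ha
        rw [LinearMap.mem_ker]
        ext x
        refine modMk_eq_zero _ ?_
        have := smul_mem_pow ha x.2
        rwa [add_right_comm] at this))
    (by
      intro x hx
      replace hx := Submodule.mem_comap.1 hx
      rw [LinearMap.mem_ker]
      ext a
      exact modMk_eq_zero (smul_mem_pow a.2 x.2) (smul_mem_pow (j := j + 1) a.2 hx))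

variable {I M}

theorem mulHom_mk {i j : ℕ} {a b : R} (ha : a ∈ I ^ i) (hb : b ∈ I ^ j) :
    mulHom I i j (ringMk i a ha) (ringMk j b hb) = ringMk (i + j) (a * b) (mul_mem_pow ha hb) :=
  rfl

theorem smulHom_mk {i j : ℕ} {a : R} {x : M} (ha : a ∈ I ^ i)
    (hx : x ∈ I ^ j • (⊤ : Submodule R M)) :
    smulHom I M i j (ringMk i a ha) (modMk j x hx) =
      modMk (i + j) (a • x) (smul_mem_pow ha hx) :=
  rfl

theorem ringMk_sigma_ext {i j : ℕ} {a b : R} (hij : i = j) (hab : a = b) (ha : a ∈ I ^ i)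
    (hb : b ∈ I ^ j) :
    (GradedMonoid.mk i (ringMk i a ha) : GradedMonoid (RingPiece I)) =
      GradedMonoid.mk j (ringMk j b hb) := by
  subst hij; subst hab; rfl

theorem modMk_sigma_ext {i j : ℕ} {x y : M} (hij : i = j) (hxy : x = y)
    (hx : x ∈ I ^ i • (⊤ : Submodule R M)) (hy : y ∈ I ^ j • (⊤ : Submodule R M)) :
    (GradedMonoid.mk i (modMk i x hx) : GradedMonoid (ModPiece I M)) =
      GradedMonoid.mk j (modMk j y hy) := by
  subst hij; subst hxy; rfl

theorem mem_pow_zero (a : R) : a ∈ I ^ 0 := by simp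

instance instGMul : GradedMonoid.GMul (RingPiece I) where
  mul {i j} a b := mulHom I i j a b

instance instGOne : GradedMonoid.GOne (RingPiece I) where
  one := ringMk 0 1 (mem_pow_zero 1)

instance instGMonoid : GradedMonoid.GMonoid (RingPiece I) where
  one_mul := by
    rintro ⟨i, a⟩
    induction a using ringPiece_ind with
    | h a ha => exact ringMk_sigma_ext (zero_add i) (one_mul a) _ _
  mul_one := by
    rintro ⟨i, a⟩
    induction a using ringPiece_ind with
    | h a ha => exact ringMk_sigma_ext (add_zero i) (mul_one a) _ _
  mul_assoc := by
    rintro ⟨i, a⟩ ⟨j, b⟩ ⟨k, c⟩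
    induction a using ringPiece_ind with
    | h a ha =>
      induction b using ringPiece_ind with
      | h b hb =>
        induction c using ringPiece_ind with
        | h c hc => exact ringMk_sigma_ext (add_assoc i j k) (mul_assoc a b c) _ _

instance instGCommRing : DirectSum.GCommRing (RingPiece I) where
  toGMonoid := instGMonoid
  mul_zero a := map_zero (mulHom I _ _ a)
  zero_mul b := LinearMap.map_zero₂ (mulHom I _ _) b
  mul_add a b c := map_add (mulHom I _ _ a) b c
  add_mul a b c := LinearMap.map_add₂ (mulHom I _ _) a b c
  natCast n := ringMk 0 (n : R) (mem_pow_zero _)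
  natCast_zero := congrArg Submodule.Quotient.mk (Subtype.ext Nat.cast_zero)
  natCast_succ n := congrArg Submodule.Quotient.mk (Subtype.ext (Nat.cast_succ n))
  intCast n := ringMk 0 (n : R) (mem_pow_zero _)
  intCast_ofNat n := congrArg Submodule.Quotient.mk (Subtype.ext (Int.cast_natCast n))
  intCast_negSucc_ofNat n := congrArg Submodule.Quotient.mk (Subtype.ext (Int.cast_negSucc n))
  mul_comm := by
    rintro ⟨i, a⟩ ⟨j, b⟩
    induction a using ringPiece_ind with
    | h a ha =>
      induction b using ringPiece_ind with
      | h b hb => exact ringMk_sigma_ext (add_comm i j) (mul_comm a b) _ _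

instance instGmodule : DirectSum.Gmodule (RingPiece I) (ModPiece I M) where
  smul {i j} a x := smulHom I M i j a x
  one_smul := by
    rintro ⟨i, x⟩
    induction x using modPiece_ind with
    | h x hx => exact modMk_sigma_ext (zero_add i) (one_smul R x) _ _
  mul_smul := by
    rintro ⟨i, a⟩ ⟨j, b⟩ ⟨k, x⟩
    induction a using ringPiece_ind with
    | h a ha =>
      induction b using ringPiece_ind with
      | h b hb =>
        induction x using modPiece_ind with
        | h x hx => exact modMk_sigma_ext (add_assoc i j k) (mul_smul a b x) _ _
  smul_add a x y := map_add (smulHom I M _ _ a) x y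
  smul_zero a := map_zero (smulHom I M _ _ a)
  add_smul a b x := LinearMap.map_add₂ (smulHom I M _ _) a b x
  zero_smul x := LinearMap.map_zero₂ (smulHom I M _ _) x

end

end AssocGraded

section

variable {R : Type u} [CommRing R] (I : Ideal R) (M : Type v) [AddCommGroup M] [Module R M]

/-- The associated graded ring `⨁ i, I ^ i / I ^ (i + 1)`. Its commutative ring structure is the
one of `DirectSum`, coming from `AssocGraded.instGCommRing`. -/
abbrev AssocGradedRing : Type u := ⨁ i, AssocGraded.RingPiece I i

/-- The associated graded module `⨁ i, I ^ i M / I ^ (i + 1) M`, a module over `AssocGradedRing I`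
through `AssocGraded.instGmodule`. -/
abbrev AssocGradedModule : Type v := ⨁ i, AssocGraded.ModPiece I M i

end

/-- The image of the `i`-th summand in a direct sum, as a subgroup. -/
def DirectSum.summand {P : ℕ → Type v} [∀ i, AddCommGroup (P i)] (i : ℕ) :
    AddSubgroup (⨁ i, P i) :=
  (DirectSum.of P i).range

/-- The inclusion of the `i`-th summand, with values in its image. -/
def DirectSum.toSummand {P : ℕ → Type v} [∀ i, AddCommGroup (P i)] (i : ℕ) :
    P i →+ ↥(DirectSum.summand (P := P) i) where
  toFun x := ⟨DirectSum.of P i x, x, rfl⟩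
  map_zero' := Subtype.ext (map_zero _)
  map_add' x y := Subtype.ext (map_add _ x y)

noncomputable instance DirectSum.summandDecomposition {P : ℕ → Type v}
    [∀ i, AddCommGroup (P i)] :
    DirectSum.Decomposition (DirectSum.summand (P := P)) where
  decompose' := DirectSum.toAddMonoid fun i =>
    (DirectSum.of (fun i => ↥(DirectSum.summand (P := P) i)) i).comp
      (DirectSum.toSummand i)
  left_inv x := by
    induction x using DirectSum.induction_on with
    | zero => simp
    | of i x =>
      rw [DirectSum.toAddMonoid_of, AddMonoidHom.comp_apply, DirectSum.coeAddMonoidHom_of]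
      rfl
    | add x y hx hy => rw [map_add, map_add, hx, hy]
  right_inv x := by
    induction x using DirectSum.induction_on with
    | zero => simp
    | of i x =>
      obtain ⟨x, y, rfl⟩ := x
      simp only [DirectSum.coeAddMonoidHom_of, DirectSum.toAddMonoid_of]
      rfl
    | add x y hx hy => rw [map_add, map_add, hx, hy]

section

variable {R : Type u} [CommRing R] (I : Ideal R) (M : Type v) [AddCommGroup M] [Module R M]

/-- The grading of the associated graded ring. -/
abbrev assocGradedRingGrading : ℕ → AddSubgroup (AssocGradedRing I) :=
  DirectSum.summand (P := AssocGraded.RingPiece I)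

/-- The grading of the associated graded module. -/
abbrev assocGradedModuleGrading : ℕ → AddSubgroup (AssocGradedModule I M) :=
  DirectSum.summand (P := AssocGraded.ModPiece I M)

noncomputable instance assocGradedRingGrading.gradedRing :
    GradedRing (assocGradedRingGrading I) where
  one_mem := ⟨GradedMonoid.GOne.one, rfl⟩
  mul_mem := by
    rintro i j _ _ ⟨a, rfl⟩ ⟨b, rfl⟩
    exact ⟨GradedMonoid.GMul.mul a b, (DirectSum.of_mul_of a b).symm⟩
  toDecomposition := DirectSum.summandDecomposition

instance assocGradedModuleGrading.gradedSMul :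
    SetLike.GradedSMul (assocGradedRingGrading I) (assocGradedModuleGrading I M) where
  smul_mem := by
    rintro i j _ _ ⟨a, rfl⟩ ⟨x, rfl⟩
    exact ⟨GradedMonoid.GSMul.smul a x, (DirectSum.Gmodule.of_smul_of _ _ a x).symm⟩

end

/-! ## Minimal free resolutions, Betti numbers and Poincaré series -/

/-- A resolution `⋯ → F₂ → F₁ → F₀ → M → 0` of `M` by free modules `F i = R ^ (rank i)` of finite
rank that is minimal with respect to the ideal `I`: the kernel of every map is contained in
`I` times its source. For a local ring `I` is the maximal ideal, and for a graded ring it is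
the irrelevant ideal. -/
structure MinimalFreeResolution {R : Type u} [CommRing R] (I : Ideal R) (M : Type v)
    [AddCommGroup M] [Module R M] where
  /-- the rank of the free module in homological degree `i` -/
  rank : ℕ → ℕ
  /-- the augmentation `F₀ → M` -/
  aug : (Fin (rank 0) → R) →ₗ[R] M
  /-- the differential `F (i + 1) → F i` -/
  d : ∀ i, (Fin (rank (i + 1)) → R) →ₗ[R] (Fin (rank i) → R)
  aug_surjective : Function.Surjective aug
  exact_aug : Function.Exact (d 0) aug
  exact_d : ∀ i, Function.Exact (d (i + 1)) (d i)
  ker_aug_le : LinearMap.ker aug ≤ I • ⊤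
  ker_d_le : ∀ i, LinearMap.ker (d i) ≤ I • ⊤

namespace MinimalFreeResolution

section existence

variable {R : Type u} [CommRing R] [IsLocalRing R]

theorem exists_minimal_cover (N : Type v) [AddCommGroup N] [Module R N] [Module.Finite R N] :
    ∃ (n : ℕ) (f : (Fin n → R) →ₗ[R] N), Function.Surjective f ∧
      LinearMap.ker f ≤ IsLocalRing.maximalIdeal R • ⊤ := by
  classical
  have hex : ∃ n : ℕ, ∃ f : (Fin n → R) →ₗ[R] N, Function.Surjective f :=
    Module.Finite.exists_fin' R N
  obtain ⟨f, hf⟩ := Nat.find_spec hex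
  refine ⟨Nat.find hex, f, hf, ?_⟩
  have hmin : ∀ m < Nat.find hex, ¬ ∃ f : (Fin m → R) →ₗ[R] N, Function.Surjective f :=
    fun m hm => Nat.find_min hex hm
  generalize Nat.find hex = n at f hf hmin
  intro v hv
  have key : ∀ l, v l ∈ IsLocalRing.maximalIdeal R := by
    intro l
    by_contra hl
    rw [IsLocalRing.mem_maximalIdeal, mem_nonunits_iff, not_not] at hl
    obtain ⟨c, hc⟩ := hl.exists_left_inv
    cases n with
    | zero => exact l.elim0
    | succ m =>
      refine hmin m (Nat.lt_succ_self m)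
        ⟨f ∘ₗ LinearMap.pi (fun k => if h : ∃ j, l.succAbove j = k then
          LinearMap.proj h.choose else 0), ?_⟩
      intro x
      obtain ⟨w, rfl⟩ := hf x
      refine ⟨fun j => (w - (w l * c) • v) (l.succAbove j), ?_⟩
      have hv' : f v = 0 := hv
      have : f w = f (w - (w l * c) • v) := by rw [map_sub, map_smul, hv', smul_zero, sub_zero]
      rw [this, LinearMap.comp_apply]
      congr 1
      ext k
      rw [LinearMap.pi_apply]
      split_ifs with h
      · rw [LinearMap.proj_apply, h.choose_spec]
      · have hk : k = l := by
          by_contra hkl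
          exact h (Fin.exists_succAbove_eq hkl)
        subst hk
        simp [mul_assoc, hc]
  have hsum : v = ∑ l, v l • (Pi.single l (1 : R) : Fin n → R) := by
    ext k
    simp [Finset.sum_apply, Pi.single_apply]
  rw [hsum]
  exact Submodule.sum_mem _ fun l _ => Submodule.smul_mem_smul (key l) trivial

variable [IsNoetherianRing R] (M : Type v) [AddCommGroup M] [Module R M] [Module.Finite R M]

/-- Every finitely generated module over a Noetherian local ring has a minimal free resolution. -/
theorem nonempty : Nonempty (MinimalFreeResolution (IsLocalRing.maximalIdeal R) M) := by
  classical
  choose n f hf hk using fun (s : Σ n : ℕ, Submodule R (Fin n → R)) =>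
    exists_minimal_cover (R := R) s.2
  obtain ⟨n₀, f₀, hf₀, hk₀⟩ := exists_minimal_cover (R := R) M
  let s : ℕ → Σ n : ℕ, Submodule R (Fin n → R) := fun i =>
    Nat.rec ⟨n₀, LinearMap.ker f₀⟩ (fun _ t => ⟨n t, LinearMap.ker (f t)⟩) i
  have hker : ∀ t, LinearMap.ker (t.2.subtype ∘ₗ f t) = LinearMap.ker (f t) := fun t =>
    LinearMap.ker_comp_of_ker_eq_bot _ t.2.ker_subtype
  have hrange : ∀ t, LinearMap.range (t.2.subtype ∘ₗ f t) = t.2 := fun t => by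
    rw [LinearMap.range_comp, LinearMap.range_eq_top.2 (hf t), Submodule.map_top,
      Submodule.range_subtype]
  exact ⟨{
    rank := fun i => (s i).1
    aug := f₀
    d := fun i => (s i).2.subtype ∘ₗ f (s i)
    aug_surjective := hf₀
    exact_aug := LinearMap.exact_iff.2 (hrange (s 0)).symm
    exact_d := fun i => LinearMap.exact_iff.2 ((hker (s i)).trans (hrange (s (i + 1))).symm)
    ker_aug_le := hk₀
    ker_d_le := fun i => (hker (s i)).trans_le (hk (s i)) }⟩

end existence

end MinimalFreeResolution

section

variable (R : Type u) [CommRing R] [IsLocalRing R] [IsNoetherianRing R]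
  (M : Type v) [AddCommGroup M] [Module R M] [Module.Finite R M]

/-- The `i`-th Betti number of a finitely generated module over a Noetherian local ring: the rank
of the `i`-th free module in a minimal free resolution (unique up to isomorphism). -/
noncomputable def bettiNumber (i : ℕ) : ℕ :=
  (MinimalFreeResolution.nonempty (R := R) M).some.rank i

/-- The Poincaré series `∑ i, β i z ^ i` of a finitely generated module over a Noetherian local
ring. -/
noncomputable def poincareSeries : PowerSeries ℤ :=
  PowerSeries.mk fun i => (bettiNumber R M i : ℤ)

end

/-- A formal power series is rational if it is a quotient of two polynomials. -/
def PowerSeries.IsRational (P : PowerSeries ℤ) : Prop :=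
  ∃ f g : Polynomial ℤ, g ≠ 0 ∧ (g : PowerSeries ℤ) * P = (f : PowerSeries ℤ)

/-! ## Graded minimal free resolutions, linear resolutions, Koszul algebras -/

section

variable {A : Type u} [CommRing A] (𝒜 : ℕ → AddSubgroup A)

/-- The degree `j` elements of the graded free module `⨁ l, A (-deg l)`, whose `l`-th basis vector
has degree `deg l`. -/
def freeGrading {n : ℕ} (deg : Fin n → ℕ) (j : ℕ) : Set (Fin n → A) :=
  {w | ∀ l, if deg l ≤ j then w l ∈ 𝒜 (j - deg l) else w l = 0}

variable [GradedRing 𝒜] {M : Type v} [AddCommGroup M] [Module A M] (ℳ : ℕ → AddSubgroup M)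

/-- A graded minimal free resolution of the graded module `M = ⨁ j, ℳ j` over the graded ring
`A = ⨁ j, 𝒜 j`: a minimal free resolution with respect to the irrelevant ideal `A₊`, whose free
modules are graded, `F i = ⨁ l, A (-deg i l)`, and whose maps are graded of degree zero. -/
structure GradedMinimalFreeResolution extends
    MinimalFreeResolution (HomogeneousIdeal.irrelevant 𝒜).toIdeal M where
  /-- the degrees of the basis vectors of the free module in homological degree `i` -/
  deg : ∀ i, Fin (rank i) → ℕ
  aug_graded : ∀ j, ∀ w ∈ freeGrading 𝒜 (deg 0) j, aug w ∈ ℳ j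
  d_graded : ∀ i j, ∀ w ∈ freeGrading 𝒜 (deg (i + 1)) j, d i w ∈ freeGrading 𝒜 (deg i) j

variable {𝒜 ℳ} in
/-- The graded Betti number `β i j`: the number of basis vectors (minimal generators) of degree `j`
in homological degree `i`. -/
def GradedMinimalFreeResolution.gradedBetti (F : GradedMinimalFreeResolution 𝒜 ℳ) (i j : ℕ) : ℕ :=
  (Finset.univ.filter fun l => F.deg i l = j).card

/-- `M = ⨁ j, ℳ j` has a linear resolution over `A = ⨁ j, 𝒜 j`: for some `δ₀`, the graded
Betti numbers satisfy `β i j ≠ 0 → j = δ₀ + i`. -/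
def HasLinearResolution : Prop :=
  ∃ F : GradedMinimalFreeResolution 𝒜 ℳ, ∃ δ₀ : ℕ, ∀ i j, F.gradedBetti i j ≠ 0 → j = δ₀ + i

/-- The grading of `A ⧸ A₊` induced by the grading of `A`. -/
def residueGrading (j : ℕ) : AddSubgroup (A ⧸ (HomogeneousIdeal.irrelevant 𝒜).toIdeal) :=
  (𝒜 j).map (Ideal.Quotient.mk (HomogeneousIdeal.irrelevant 𝒜).toIdeal : A →+ _)

/-- A graded ring `A = ⨁ j, 𝒜 j` with `A₀ = k` a field is Koszul if the graded module
`k = A ⧸ A₊` has a linear resolution over `A`. -/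
def IsKoszul : Prop :=
  HasLinearResolution 𝒜 (residueGrading 𝒜)

end

/-! Write `H_N` for the Hilbert series of the associated graded module of `N`. The core is that a
linear resolution over the associated graded ring lifts, one syzygy at a time, to the minimal
resolution over `R`. Let `D : F → N` be a free cover that induces `d` on initial forms (`IsLift`),
let `d'` be exact before `d` with entries of degree 1, and put `K = ker D`. Lifting the columns of
`d'` to `K`, approximating `m`-adically and applying Artin–Rees gives `K ∩ m^(j+1) F = m^j K`,
together with a cover of `K` that induces `d'` (`IsLift.exists_lift_ker`). So the hypothesis is
inherited by the syzygy.

The filtration equality says that the associated graded module of `K`, shifted by one, is the kernel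
of the map of associated graded modules for `F → N`. Counting lengths gives `H_N = r H_R - z H_K`
(`localHilbertSeries_eq_sub`), and iterating over all syzygies gives `H_R(z) P(-z) = H_N(z)`
(`PowerSeries.mul_evalNegHom_eq`). Both Hilbert series are rational by Hilbert–Serre
(`isRational_subquotientSeries`) and `H_R ≠ 0`, so `P` is rational.

The induction starts from a cover that lifts the augmentation:
`exists_isLift_of_isModuleInitialForm` for `M`, `exists_isLift_residueField` for `k`. The latter is
separate because Koszulness concerns `A / A₊` rather than the associated graded module of `k`. -/

/-! ## Lengths of subquotients and Hilbert series -/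

section SubquotientLength

variable {R : Type*} [CommRing R] {X Y : Type*} [AddCommGroup X] [Module R X]
  [AddCommGroup Y] [Module R Y]

/-- The length of `(T + B) / B` for submodules `B`, `T` of a module. -/
noncomputable def subquotientLength (B T : Submodule R X) : ℕ∞ :=
  Module.length R (T.map B.mkQ)

/-- The map `X / f⁻¹(B) → Y / B` is injective and carries the image of `T` onto the image of `f(T)`.
-/
theorem subquotientLength_comap (f : X →ₗ[R] Y) (B : Submodule R Y) (T : Submodule R X) :
    subquotientLength (B.comap f) T = subquotientLength B (T.map f) := by
  have hinj : Function.Injective ((B.comap f).mapQ B f le_rfl) := by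
    rw [← LinearMap.ker_eq_bot, Submodule.ker_mapQ, ← LinearMap.le_ker_iff_map]
    simp
  unfold subquotientLength
  rw [((T.map (B.comap f).mkQ).equivMapOfInjective _ hinj).length_eq, ← Submodule.map_comp,
    ← Submodule.map_comp]
  rfl

theorem subquotientLength_eq_zero {B T : Submodule R X} (h : T ≤ B) :
    subquotientLength B T = 0 := by
  rw [subquotientLength, (LinearMap.le_ker_iff_map (f := B.mkQ)).1 (by simpa using h)]
  exact Module.length_bot

theorem subquotientLength_sup_left (B T : Submodule R X) :
    subquotientLength B (B ⊔ T) = subquotientLength B T := by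
  rw [subquotientLength, Submodule.map_sup, (LinearMap.le_ker_iff_map (f := B.mkQ)).1 (by simp),
    bot_sup_eq]
  rfl

theorem subquotientLength_inf_left (B T : Submodule R X) :
    subquotientLength (B ⊓ T) T = subquotientLength B T := by
  have h (C : Submodule R X) :
      subquotientLength C T = subquotientLength (C.comap T.subtype) ⊤ := by
    rw [subquotientLength_comap, Submodule.map_top, Submodule.range_subtype]
  rw [h, h B]
  congr 1
  ext; simp

theorem subquotientLength_add {B C T : Submodule R X} (hBC : B ≤ C) (hCT : C ≤ T) :
    subquotientLength B T = subquotientLength B C + subquotientLength C T := by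
  let g : ↥(T.map B.mkQ) →ₗ[R] ↥(T.map C.mkQ) :=
    (B.mapQ C LinearMap.id hBC).restrict (p := T.map B.mkQ) (q := T.map C.mkQ) (by
      rintro _ ⟨x, hx, rfl⟩
      exact ⟨x, hx, rfl⟩)
  refine Module.length_eq_add_of_exact (Submodule.inclusion (Submodule.map_mono hCT)) g
    (Submodule.inclusion_injective _) ?_ ?_
  · rintro ⟨_, x, hx, rfl⟩
    exact ⟨⟨_, x, hx, rfl⟩, rfl⟩
  · rintro ⟨_, x, hx, rfl⟩
    constructor
    · intro h
      have h' : C.mkQ x = 0 := congrArg Subtype.val h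
      exact ⟨⟨_, x, by simpa using h', rfl⟩, rfl⟩
    · rintro ⟨⟨_, y, hy, rfl⟩, h⟩
      rw [← h]
      refine Subtype.ext (?_ : C.mkQ y = 0)
      simpa using hy

theorem subquotientLength_antitone {B B' T : Submodule R X} (h : B ≤ B') :
    subquotientLength B' T ≤ subquotientLength B T := by
  rw [← subquotientLength_inf_left B, ← subquotientLength_inf_left B',
    subquotientLength_add (inf_le_inf_right T h) inf_le_right]
  exact le_add_self

/-- Insert `B + (T ∩ K)` between `B` and `T` and identify the two layers by the modular law. With
`K` the kernel of a cover, this splits a layer of the free module into a layer of the kernel and one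
of the image. -/
theorem subquotientLength_modular {B T : Submodule R X} (h : B ≤ T) (K : Submodule R X) :
    subquotientLength B T =
      subquotientLength (B ⊓ K) (T ⊓ K) + subquotientLength (B ⊔ K) (T ⊔ K) := by
  have h₁ : subquotientLength (B ⊓ K) (T ⊓ K) = subquotientLength B (B ⊔ (T ⊓ K)) := by
    rw [subquotientLength_sup_left, ← subquotientLength_inf_left B (T ⊓ K), ← inf_assoc,
      inf_eq_left.2 h]
  have h₂ : subquotientLength (B ⊔ K) (T ⊔ K) = subquotientLength (B ⊔ (T ⊓ K)) T := by
    have e : T ⊔ K = (B ⊔ K) ⊔ T := by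
      rw [sup_right_comm, sup_eq_right.2 h]
    rw [e, subquotientLength_sup_left, ← subquotientLength_inf_left (B ⊔ K), inf_comm T K,
      sup_inf_assoc_of_le K h]
  rw [h₁, h₂]
  exact subquotientLength_add le_sup_left (sup_le h inf_le_left)

theorem subquotientLength_pi {n : ℕ} (B T : Submodule R X) :
    subquotientLength (Submodule.pi Set.univ fun _ : Fin n => B)
      (Submodule.pi Set.univ fun _ : Fin n => T) = n * subquotientLength B T := by
  -- Viewing `B^n` as the preimage of zero under the componentwise quotient map reduces the count to
  -- the length of a power of `(T + B) / B`.
  have hB : (Submodule.pi Set.univ fun _ : Fin n => B) =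
      (⊥ : Submodule R (Fin n → X ⧸ B)).comap (LinearMap.piMap fun _ => B.mkQ) := by
    ext w
    simp [Submodule.mem_pi, funext_iff]
  rw [hB, subquotientLength_comap]
  have e : subquotientLength (⊥ : Submodule R (Fin n → X ⧸ B))
      ((Submodule.pi Set.univ fun _ : Fin n => T).map (LinearMap.piMap fun _ => B.mkQ)) =
      Module.length R (Fin n → ↥(T.map B.mkQ)) := by
    let g : (Fin n → ↥(T.map B.mkQ)) →ₗ[R] ((Fin n → X ⧸ B) ⧸ (⊥ : Submodule R _)) :=
      (Submodule.mkQ ⊥) ∘ₗ LinearMap.piMap fun _ => (T.map B.mkQ).subtype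
    have hg : Function.Injective g := by
      intro v w h
      have h' := (Submodule.quotEquivOfEqBot (⊥ : Submodule R (Fin n → X ⧸ B)) rfl).symm.injective h
      funext i
      exact Subtype.ext (congrFun h' i)
    rw [(LinearEquiv.ofInjective g hg).length_eq, subquotientLength]
    refine congrArg (fun S : Submodule R _ => Module.length R S) ?_
    ext y
    constructor
    · rintro ⟨_, ⟨w, hw, rfl⟩, rfl⟩
      exact ⟨fun i => ⟨_, w i, hw i trivial, rfl⟩, rfl⟩
    · rintro ⟨w, rfl⟩
      choose x hx hxw using fun i => (w i).2
      refine ⟨_, ⟨x, fun i _ => hx i, rfl⟩, ?_⟩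
      change _ = Submodule.mkQ ⊥ _
      congr 1
      funext i
      exact hxw i
  rw [e, Module.length_pi_of_fintype]
  simp [subquotientLength]

end SubquotientLength

/-! ### Finiteness of lengths over a local ring -/

section Finite

variable {R : Type*} [CommRing R] [IsLocalRing R]

/-- A surjection from `R^n` kills `m^n` (the product of `n` copies of `m`), so the length is at most
`n` times that of the simple module `R / m`. -/
theorem Module.length_ne_top_of_maximalIdeal_smul_eq_bot {X : Type*} [AddCommGroup X] [Module R X]
    [Module.Finite R X] (h : IsLocalRing.maximalIdeal R • (⊤ : Submodule R X) = ⊥) :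
    Module.length R X ≠ ⊤ := by
  obtain ⟨n, f, hf⟩ := Module.Finite.exists_fin' R X
  have hk : (Submodule.pi Set.univ fun _ : Fin n => IsLocalRing.maximalIdeal R) ≤
      LinearMap.ker f := by
    intro w hw
    rw [LinearMap.mem_ker, ← Submodule.mem_bot R, ← h, pi_eq_sum_univ' w, map_sum]
    refine Submodule.sum_mem _ fun i _ => ?_
    rw [map_smul]
    exact Submodule.smul_mem_smul (hw i trivial) trivial
  have h₁ : Module.length R X = subquotientLength (LinearMap.ker f) ⊤ := by
    rw [← Submodule.comap_bot, subquotientLength_comap, Submodule.map_top,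
      LinearMap.range_eq_top.2 hf, subquotientLength, Submodule.map_top, Submodule.range_mkQ,
      Module.length_top]
    exact (Submodule.quotEquivOfEqBot _ rfl).symm.length_eq
  have h₂ := (subquotientLength_antitone (T := ⊤) hk).trans_eq
    (congrArg _ (Submodule.pi_top (s := Set.univ)).symm)
  rw [subquotientLength_pi] at h₂
  have h₃ : subquotientLength (IsLocalRing.maximalIdeal R) ⊤ = 1 := by
    rw [subquotientLength, Submodule.map_top, Submodule.range_mkQ, Module.length_top]
    have : IsSimpleModule R (R ⧸ IsLocalRing.maximalIdeal R) :=
      isSimpleModule_iff_isCoatom.2 (IsLocalRing.maximalIdeal.isMaximal R).out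
    exact Module.length_eq_one R _
  rw [h₃, mul_one] at h₂
  rw [h₁]
  exact ne_top_of_le_ne_top (ENat.natCast_ne_top n) h₂

theorem subquotientLength_ne_top {X : Type*} [AddCommGroup X] [Module R X]
    {B T : Submodule R X} (hT : T.FG) (h : IsLocalRing.maximalIdeal R • T ≤ B) :
    subquotientLength B T ≠ ⊤ := by
  have : Module.Finite R ↥(T.map B.mkQ) := Module.Finite.iff_fg.2 (hT.map _)
  refine Module.length_ne_top_of_maximalIdeal_smul_eq_bot ?_
  have : (IsLocalRing.maximalIdeal R • (⊤ : Submodule R ↥(T.map B.mkQ))).map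
      (T.map B.mkQ).subtype = ⊥ := by
    rw [Submodule.map_smul'', Submodule.map_top, Submodule.range_subtype, ← Submodule.map_smul'',
      ← LinearMap.le_ker_iff_map]
    simpa using h
  rwa [← LinearMap.le_ker_iff_map, Submodule.ker_subtype, le_bot_iff] at this

end Finite

/-! ## Rationality of Hilbert series -/

namespace PowerSeries.IsRational

open Polynomial

theorem add {P Q : PowerSeries ℤ} (hP : P.IsRational) (hQ : Q.IsRational) :
    (P + Q).IsRational := by
  obtain ⟨f, g, hg, h⟩ := hP
  obtain ⟨f', g', hg', h'⟩ := hQ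
  refine ⟨g' * f + g * f', g * g', mul_ne_zero hg hg', ?_⟩
  push_cast
  rw [← h, ← h']
  ring

theorem coe_mul {P : PowerSeries ℤ} (p : Polynomial ℤ) (hP : P.IsRational) :
    ((p : PowerSeries ℤ) * P).IsRational := by
  obtain ⟨f, g, hg, h⟩ := hP
  refine ⟨p * f, g, hg, ?_⟩
  push_cast
  rw [← h]
  ring

theorem of_coe_mul {P : PowerSeries ℤ} {p : Polynomial ℤ} (hp : p ≠ 0)
    (hP : ((p : PowerSeries ℤ) * P).IsRational) : P.IsRational := by
  obtain ⟨f, g, hg, h⟩ := hP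
  refine ⟨f, g * p, mul_ne_zero hg hp, ?_⟩
  push_cast
  rw [← h]
  ring

theorem of_eventually_zero {P : PowerSeries ℤ} (n : ℕ) (h : ∀ j ≥ n, coeff j P = 0) :
    P.IsRational := by
  refine ⟨P.trunc n, 1, one_ne_zero, ?_⟩
  ext j
  rw [Polynomial.coe_one, one_mul, Polynomial.coeff_coe, PowerSeries.coeff_trunc]
  split_ifs with hj
  · rfl
  · exact h j (not_lt.1 hj)

/-- A quotient of rational power series is rational. -/
theorem of_mul_eq {P H G : PowerSeries ℤ} (hH : H.IsRational) (hG : G.IsRational) (h0 : H ≠ 0)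
    (h : H * P = G) : P.IsRational := by
  obtain ⟨f, g, hg, hf⟩ := hH
  obtain ⟨f', g', hg', hf'⟩ := hG
  have hf0 : f ≠ 0 := by
    rintro rfl
    rw [Polynomial.coe_zero] at hf
    exact mul_ne_zero (by simpa using hg) h0 hf
  refine ⟨g * f', f * g', mul_ne_zero hf0 hg', ?_⟩
  push_cast
  rw [← hf, ← hf', ← h]
  ring

/-- Needed because the alternating signs along a resolution produce `P(-z)`. On polynomials the
substitution is composition with `-X`, an involution, so the denominator stays nonzero. -/
theorem evalNegHom {P : PowerSeries ℤ} (hP : P.IsRational) :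
    (PowerSeries.evalNegHom P).IsRational := by
  obtain ⟨f, g, hg, h⟩ := hP
  have key (p : Polynomial ℤ) :
      PowerSeries.evalNegHom (p : PowerSeries ℤ) =
        ((p.comp (-Polynomial.X) : Polynomial ℤ) : PowerSeries ℤ) := by
    induction p using Polynomial.induction_on' with
    | add p q hp hq => simp [hp, hq]
    | monomial n a =>
      rw [Polynomial.coe_monomial, Polynomial.monomial_comp, PowerSeries.evalNegHom]
      ext j
      have hX : (-Polynomial.X : Polynomial ℤ) ^ n = Polynomial.C ((-1) ^ n) * Polynomial.X ^ n := by
        rw [neg_pow, Polynomial.C_pow, Polynomial.C_neg, Polynomial.C_1]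
      rw [PowerSeries.coeff_rescale, hX, ← mul_assoc, ← Polynomial.C_mul, Polynomial.coeff_coe,
        Polynomial.coeff_C_mul_X_pow, PowerSeries.coeff_monomial]
      split_ifs with hj
      · rw [hj, mul_comm]
      · simp
  refine ⟨f.comp (-Polynomial.X), g.comp (-Polynomial.X), ?_, ?_⟩
  · intro h0
    apply hg
    have := congrArg (fun p => Polynomial.comp p (-Polynomial.X)) h0
    simpa [Polynomial.comp_assoc] using this
  · rw [← key, ← key, ← map_mul, h]

end PowerSeries.IsRational

/-! ### The Hilbert–Serre theorem for filtrations -/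

section

variable {R : Type*} [CommRing R] [IsLocalRing R]

local notation "𝔪" => IsLocalRing.maximalIdeal R

/-- The generating function of the lengths of the subquotients `T j / B j`. -/
noncomputable def subquotientSeries {M : Type*} [AddCommGroup M] [Module R M]
    (B T : ℕ → Submodule R M) : PowerSeries ℤ :=
  PowerSeries.mk fun j => ((subquotientLength (B j) (T j)).toNat : ℤ)

/-- The Hilbert series of the associated graded module of `M`. -/
noncomputable def localHilbertSeries (R : Type*) [CommRing R] [IsLocalRing R]
    (M : Type*) [AddCommGroup M] [Module R M] : PowerSeries ℤ :=
  subquotientSeries (R := R) (M := M) (fun j => IsLocalRing.maximalIdeal R ^ (j + 1) • ⊤)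
    (fun j => IsLocalRing.maximalIdeal R ^ j • ⊤)

variable [IsNoetherianRing R] {M : Type*} [AddCommGroup M] [Module R M] [Module.Finite R M]

/-- Artin–Rees: over a Noetherian ring a filtration contained in the stable `m`-adic one is stable.
It plays the role of finite generation of a graded submodule. -/
theorem exists_eq_smul_of_le_pow_smul {T : ℕ → Submodule R M} (hT : ∀ j, 𝔪 • T j ≤ T (j + 1))
    (hmono : ∀ j, T (j + 1) ≤ T j) (hle : ∀ j, T j ≤ 𝔪 ^ j • ⊤) :
    ∃ n, ∀ j ≥ n, T (j + 1) = 𝔪 • T j := by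
  obtain ⟨n, hn⟩ := Ideal.Filtration.Stable.of_le (Ideal.stableFiltration_stable 𝔪 (⊤ : Submodule R M))
    (F' := ⟨T, hmono, hT⟩) (fun j => hle j)
  exact ⟨n, fun j hj => (hn j hj).symm⟩

/-- The Hilbert–Serre theorem for a graded subquotient `⨁ j, T j / B j` of the associated graded
module of `M`. -/
theorem isRational_subquotientSeries (g : Set R) (hg : Ideal.span g = 𝔪) (s : Finset R)
    (B T : ℕ → Submodule R M) (hB : ∀ j, 𝔪 • B j ≤ B (j + 1)) (hT : ∀ j, 𝔪 • T j ≤ T (j + 1))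
    (hpow : ∀ j, 𝔪 ^ (j + 1) • ⊤ ≤ B j) (hBT : ∀ j, B j ≤ T j) (hle : ∀ j, T j ≤ 𝔪 ^ j • ⊤)
    (hs : ∀ x ∈ g, x ∈ s ∨ ∀ j, ∀ t ∈ T j, x • t ∈ B (j + 1)) :
    (subquotientSeries B T).IsRational := by
  classical
  -- Generators outside `s` act as zero on `⨁ T j / B j`. The induction is on the number of
  -- generators still allowed to act.
  induction s using Finset.induction_on generalizing B T with
  | empty =>
    obtain ⟨n, hn⟩ := exists_eq_smul_of_le_pow_smul hT
      (fun j => (hle (j + 1)).trans ((hpow j).trans (hBT j))) hle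
    -- All generators now act as zero, so `T (j+1) = m T j ≤ B (j+1)` once `j ≥ n`, and the series
    -- is a polynomial.
    refine PowerSeries.IsRational.of_eventually_zero (n + 1) fun j hj => ?_
    obtain ⟨j, rfl⟩ : ∃ k, j = k + 1 := ⟨j - 1, by omega⟩
    rw [subquotientSeries, PowerSeries.coeff_mk, subquotientLength_eq_zero]
    · simp
    · rw [hn j (by omega), ← hg, Submodule.span_smul_eq, Submodule.set_smul_le_iff]
      intro x t hx ht
      exact ((hs x hx).resolve_left (by simp)) j t ht
  | insert x s _ ih =>
    by_cases hxm : x ∈ 𝔪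
    swap
    -- The set `s` is arbitrary, so `x` may lie outside `m`. It is then not one of the generators
    -- and can be dropped.
    · refine ih B T hB hT hpow hBT hle fun y hy => ?_
      have hne : y ≠ x := by
        rintro rfl
        exact hxm (hg ▸ Ideal.subset_span hy)
      simpa [hne] using hs y hy
    let f : M →ₗ[R] M := LinearMap.lsmul R M x
    -- `T' / B` is the kernel and `T / B'` the cokernel of multiplication by `x`, which raises the
    -- degree by one. Hence nothing is added to `B 0`. Both are killed by `x`, so induction applies.
    let T' : ℕ → Submodule R M := fun j => T j ⊓ (B (j + 1)).comap f
    let B' : ℕ → Submodule R M := fun j => Nat.casesOn j (B 0) fun i => B (i + 1) ⊔ (T i).map f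
    have hfT (j) : (T j).map f ≤ T (j + 1) := by
      rintro _ ⟨t, ht, rfl⟩
      exact hT j (Submodule.smul_mem_smul hxm ht)
    have hfB (j) : (B j).map f ≤ B (j + 1) := by
      rintro _ ⟨t, ht, rfl⟩
      exact hB j (Submodule.smul_mem_smul hxm ht)
    have hBT' (j) : B j ≤ T' j := le_inf (hBT j) (Submodule.map_le_iff_le_comap.1 (hfB j))
    have hBB' (j) : B j ≤ B' j := by cases j; exacts [le_rfl, le_sup_left]
    have hB'T (j) : B' j ≤ T j := by
      cases j with
      | zero => exact hBT 0
      | succ i => exact sup_le (hBT _) (hfT i)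
    have hK : (subquotientSeries B T').IsRational := by
      refine ih B T' hB ?_ hpow hBT' (fun j => inf_le_left.trans (hle j)) ?_
      · refine fun j => le_inf ((Submodule.smul_mono le_rfl inf_le_left).trans (hT j)) ?_
        rw [← Submodule.map_le_iff_le_comap, Submodule.map_smul'']
        refine (Submodule.smul_mono le_rfl ?_).trans (hB (j + 1))
        exact Submodule.map_le_iff_le_comap.2 inf_le_right
      · intro y hy
        by_cases hyx : y = x
        · subst hyx
          exact Or.inr fun j t ht => ht.2
        · refine (hs y hy).imp (fun h => (Finset.mem_insert.1 h).resolve_left hyx) ?_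
          exact fun h j t ht => h j t ht.1
    have hC : (subquotientSeries B' T).IsRational := by
      refine ih B' T ?_ hT (fun j => (hpow j).trans (hBB' j)) hB'T hle ?_
      · intro j
        cases j with
        | zero => exact (hB 0).trans (hBB' 1)
        | succ i =>
          change 𝔪 • (B (i + 1) ⊔ (T i).map f) ≤ B (i + 2) ⊔ (T (i + 1)).map f
          rw [Submodule.smul_sup, ← Submodule.map_smul'']
          exact sup_le_sup (hB _) (Submodule.map_mono (hT i))
      · intro y hy
        by_cases hyx : y = x
        · subst hyx
          exact Or.inr fun j t ht => Submodule.mem_sup_right ⟨t, ht, rfl⟩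
        · refine (hs y hy).imp (fun h => (Finset.mem_insert.1 h).resolve_left hyx) ?_
          exact fun h j t ht => hBB' (j + 1) (h j t ht)
    have hfin (j : ℕ) {C D : Submodule R M} (h₁ : B j ≤ C) (h₂ : D ≤ T j) :
        subquotientLength C D ≠ ⊤ := by
      refine subquotientLength_ne_top (IsNoetherian.noetherian D) ?_
      refine (Submodule.smul_mono le_rfl (h₂.trans (hle j))).trans (le_trans ?_ h₁)
      rw [← mul_smul, ← pow_succ']
      exact hpow j
    -- Multiplication by `x` from degree `i` to degree `i + 1` gives `H (i+1) - H i = C (i+1) - K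
    -- i`, with `K` and `C` counting kernel and cokernel. The image length, common to `e1` and `e2`,
    -- cancels.
    have key : (((1 - Polynomial.X : Polynomial ℤ) : PowerSeries ℤ)) * subquotientSeries B T =
        subquotientSeries B' T +
          ((-Polynomial.X : Polynomial ℤ) : PowerSeries ℤ) * subquotientSeries B T' := by
      have h1 : (((1 - Polynomial.X : Polynomial ℤ) : PowerSeries ℤ)) = 1 - PowerSeries.X := by
        simp
      have h2 : ((-Polynomial.X : Polynomial ℤ) : PowerSeries ℤ) = -PowerSeries.X := by simp
      rw [h1, h2]
      ext j
      cases j with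
      | zero => simp [subquotientSeries, sub_mul, B']
      | succ i =>
        simp only [sub_mul, neg_mul, one_mul, map_sub, map_add, map_neg,
          PowerSeries.coeff_succ_X_mul, subquotientSeries, PowerSeries.coeff_mk]
        have e1 : subquotientLength (B (i + 1)) (T (i + 1)) =
            subquotientLength ((B (i + 1)).comap f) (T i) +
              subquotientLength (B' (i + 1)) (T (i + 1)) := by
          rw [subquotientLength_add (hBB' (i + 1)) (hB'T (i + 1)), subquotientLength_comap]
          congr 1
          exact subquotientLength_sup_left _ _
        have e2 : subquotientLength (B i) (T i) =
            subquotientLength (B i) (T' i) + subquotientLength ((B (i + 1)).comap f) (T i) := by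
          rw [subquotientLength_add (hBT' i) inf_le_left]
          congr 1
          rw [← subquotientLength_inf_left ((B (i + 1)).comap f), inf_comm]
        have f1 : subquotientLength ((B (i + 1)).comap f) (T i) ≠ ⊤ :=
          hfin i (Submodule.map_le_iff_le_comap.1 (hfB i)) le_rfl
        rw [e1, e2, ENat.toNat_add f1 (hfin (i + 1) (hBB' (i + 1)) le_rfl),
          ENat.toNat_add (hfin i le_rfl inf_le_left) f1]
        push_cast
        ring
    refine PowerSeries.IsRational.of_coe_mul (p := 1 - Polynomial.X) ?_
      (key ▸ hC.add (hK.coe_mul _))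
    intro h
    simpa using congrArg (Polynomial.eval 0) h

variable (R M) in
/-- The Hilbert series of the associated graded module is rational. -/
theorem isRational_localHilbertSeries : (localHilbertSeries R M).IsRational := by
  obtain ⟨s, hs⟩ := IsNoetherian.noetherian 𝔪
  have h (j : ℕ) : 𝔪 • 𝔪 ^ j • (⊤ : Submodule R M) = 𝔪 ^ (j + 1) • ⊤ := by
    rw [← mul_smul, pow_succ']
  exact isRational_subquotientSeries (s : Set R) hs s _ _ (fun j => (h _).le) (fun j => (h _).le)
    (fun j => le_rfl) (fun j => Submodule.smul_mono_left (Ideal.pow_le_pow_right j.le_succ))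
    (fun j => le_rfl) fun x hx => Or.inl hx

end

/-! ## Initial forms -/

section InitialForm

theorem Ideal.mem_smul_top_pi_iff {R : Type*} [CommRing R] {n : ℕ} (J : Ideal R) (w : Fin n → R) :
    w ∈ J • (⊤ : Submodule R (Fin n → R)) ↔ ∀ l, w l ∈ J := by
  constructor
  · intro h l
    have := Submodule.mem_map_of_mem (f := LinearMap.proj (R := R) (φ := fun _ : Fin n => R) l) h
    rw [Submodule.map_smul''] at this
    have := Submodule.smul_mono (le_refl J) le_top this
    rwa [smul_eq_mul, Ideal.mul_top] at this
  · intro h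
    rw [pi_eq_sum_univ' w]
    exact Submodule.sum_mem _ fun l _ => Submodule.smul_mem_smul (h l) trivial

theorem LinearMap.apply_eq_sum_single {A Q : Type*} [CommRing A] [AddCommGroup Q] [Module A Q]
    {n : ℕ} (d : (Fin n → A) →ₗ[A] Q) (v : Fin n → A) :
    d v = ∑ l, v l • d (Pi.single l 1) := by
  conv_lhs => rw [pi_eq_sum_univ' v]
  rw [map_sum]
  refine Finset.sum_congr rfl fun l _ => ?_
  rw [map_smul]

/-- The maps `σ j : I ^ j → A` exhibit the graded ring `A` as the associated graded ring of the
ideal `I`. -/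
structure IsInitialForm {R : Type*} [CommRing R] {I : Ideal R} {A : Type*} [CommRing A]
    (𝒜 : ℕ → AddSubgroup A) (σ : ∀ j, ↥(I ^ j) →+ A) : Prop where
  eq_zero_iff : ∀ {j : ℕ} (a : ↥(I ^ j)), σ j a = 0 ↔ (a : R) ∈ I ^ (j + 1)
  mem : ∀ {j : ℕ} (a : ↥(I ^ j)), σ j a ∈ 𝒜 j
  exists_eq : ∀ {j : ℕ} {a : A}, a ∈ 𝒜 j → ∃ b, σ j b = a
  mul : ∀ {i j : ℕ} (a : ↥(I ^ i)) (b : ↥(I ^ j)),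
    σ i a * σ j b = σ (i + j) ⟨a * b, AssocGraded.mul_mem_pow a.2 b.2⟩

/-- The initial form in degree `j` of an element of `I ^ j`. -/
noncomputable def initialForm {R : Type*} [CommRing R] (I : Ideal R) (j : ℕ) :
    ↥(I ^ j) →+ AssocGradedRing I :=
  (DirectSum.of (AssocGraded.RingPiece I) j).comp
    (Submodule.mkQ (Submodule.submoduleOf (I ^ (j + 1)) (I ^ j))).toAddMonoidHom

theorem isInitialForm_initialForm {R : Type*} [CommRing R] (I : Ideal R) :
    IsInitialForm (A := AssocGradedRing I) (assocGradedRingGrading I) (initialForm I) where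
  eq_zero_iff {j} a := by
    change DirectSum.of (AssocGraded.RingPiece I) j (AssocGraded.ringMk j a.1 a.2) = 0 ↔ _
    rw [← map_zero (DirectSum.of (AssocGraded.RingPiece I) j), (DirectSum.of_injective j).eq_iff]
    exact Submodule.Quotient.mk_eq_zero _
  mem a := ⟨_, rfl⟩
  exists_eq := by
    rintro j _ ⟨x, rfl⟩
    induction x using AssocGraded.ringPiece_ind with
    | h b hb => exact ⟨⟨b, hb⟩, rfl⟩
  mul a b := DirectSum.of_mul_of _ _

variable {R : Type*} [CommRing R] {I : Ideal R} {A : Type*} [CommRing A]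
  {𝒜 : ℕ → AddSubgroup A} [GradedRing 𝒜] {σ : ∀ j, ↥(I ^ j) →+ A}

namespace IsInitialForm

theorem mem_irrelevant_iff (hσ : IsInitialForm 𝒜 σ) (a : ↥(I ^ 0)) :
    σ 0 a ∈ (HomogeneousIdeal.irrelevant 𝒜).toIdeal ↔ (a : R) ∈ I := by
  have h : GradedRing.proj 𝒜 0 (σ 0 a) = σ 0 a := by
    rw [GradedRing.proj_apply, DirectSum.decompose_of_mem_same _ (hσ.mem a)]
  change _ ∈ HomogeneousIdeal.irrelevant 𝒜 ↔ _
  rw [HomogeneousIdeal.mem_irrelevant_iff, h, hσ.eq_zero_iff, zero_add, pow_one]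

end IsInitialForm

theorem mem_irrelevant_of_mem {j : ℕ} (hj : j ≠ 0) {a : A} (ha : a ∈ 𝒜 j) :
    a ∈ (HomogeneousIdeal.irrelevant 𝒜).toIdeal := by
  change _ ∈ HomogeneousIdeal.irrelevant 𝒜
  rw [HomogeneousIdeal.mem_irrelevant_iff, GradedRing.proj_apply,
    DirectSum.decompose_of_mem_ne _ ha hj]

namespace IsInitialForm

/-- Since `d` has entries of degree 1, the degree `j + 1` part of `d v` depends only on the degree
`j` part of `v`, which consists of initial forms. -/
theorem exists_preimage (hσ : IsInitialForm 𝒜 σ) {r s : ℕ} {d : (Fin s → A) →ₗ[A] (Fin r → A)}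
    (hd : ∀ l k, d (Pi.single l 1) k ∈ 𝒜 1) {j : ℕ} (v : Fin s → A)
    (hv : ∀ k, d v k ∈ 𝒜 (j + 1)) :
    ∃ w : Fin s → ↥(I ^ j), d (fun l => σ j (w l)) = d v := by
  choose w hw using fun l => hσ.exists_eq (DirectSum.decompose 𝒜 (v l) j).2
  refine ⟨w, ?_⟩
  have h (k) := DirectSum.decompose_of_mem_same _ (hv k)
  rw [d.apply_eq_sum_single]
  funext k
  rw [← h k, d.apply_eq_sum_single v, Finset.sum_apply,
    Finset.sum_apply, DirectSum.decompose_sum, DFinsupp.finsetSum_apply, AddSubgroup.val_finsetSum]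
  refine Finset.sum_congr rfl fun l _ => ?_
  rw [Pi.smul_apply, Pi.smul_apply, smul_eq_mul, smul_eq_mul,
    DirectSum.coe_decompose_mul_add_of_right_mem _ (hd l k), hw]

end IsInitialForm

end InitialForm

/-! ## Lifting linear resolutions -/

section Lift

variable {R : Type*} [CommRing R] {I : Ideal R} {A : Type*} [CommRing A]
  {𝒜 : ℕ → AddSubgroup A} {σ : ∀ j, ↥(I ^ j) →+ A}
  {N : Type*} [AddCommGroup N] [Module R N] {Q : Type*} [AddCommGroup Q] [Module A Q] {r : ℕ}

/-- The cover `D` of `N` by a free module induces `d` on initial forms: an element of `I ^ j F` is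
mapped by `D` into `I ^ (j + 1) N` if and only if its initial form is killed by `d`. -/
structure IsLift (σ : ∀ j, ↥(I ^ j) →+ A) (d : (Fin r → A) →ₗ[A] Q)
    (D : (Fin r → R) →ₗ[R] N) : Prop where
  surjective : Function.Surjective D
  mem_iff : ∀ (j : ℕ) (w : Fin r → ↥(I ^ j)),
    D (fun l => w l) ∈ I ^ (j + 1) • (⊤ : Submodule R N) ↔ d (fun l => σ j (w l)) = 0

namespace IsLift

variable {d : (Fin r → A) →ₗ[A] Q} {D : (Fin r → R) →ₗ[R] N}

theorem comp_linearEquiv (h : IsLift σ d D) {N' : Type*} [AddCommGroup N'] [Module R N']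
    (e : N ≃ₗ[R] N') : IsLift σ d (e.toLinearMap ∘ₗ D) where
  surjective := e.surjective.comp h.surjective
  mem_iff j w := by
    rw [← h.mem_iff]
    have : I ^ (j + 1) • (⊤ : Submodule R N') =
        (I ^ (j + 1) • (⊤ : Submodule R N)).map e.toLinearMap := by
      rw [Submodule.map_smul'', Submodule.map_top, LinearEquiv.range]
    rw [this]
    exact e.injective.mem_set_image

/-- The degree 0 initial form of a kernel element lies in `ker d`, so its entries lie in `A₊`. Being
of degree 0 they vanish, and the element has entries in `I`. -/
theorem ker_le [GradedRing 𝒜] (hσ : IsInitialForm 𝒜 σ) (h : IsLift σ d D)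
    (hd : LinearMap.ker d ≤ (HomogeneousIdeal.irrelevant 𝒜).toIdeal • ⊤) :
    LinearMap.ker D ≤ I • ⊤ := by
  intro w hw
  have h0 : d (fun l => σ 0 ⟨w l, AssocGraded.mem_pow_zero _⟩) = 0 := by
    rw [← h.mem_iff]
    change D w ∈ _
    rw [LinearMap.mem_ker.1 hw]
    exact zero_mem _
  have := (Ideal.mem_smul_top_pi_iff _ _).1 (hd h0)
  exact (Ideal.mem_smul_top_pi_iff _ _).2 fun l => (hσ.mem_irrelevant_iff _).1 (this l)

/-- If `d` kills the initial form of `v`, then `D v` lies in `I^(j+1) N = D (I^(j+1) F)`.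
Subtracting a preimage from that deeper layer corrects `v` without changing its initial form. -/
theorem exists_mem_ker (hσ : IsInitialForm 𝒜 σ) (h : IsLift σ d D) {j : ℕ}
    (v : Fin r → ↥(I ^ j)) (hv : d (fun l => σ j (v l)) = 0) :
    ∃ w : Fin r → ↥(I ^ j), D (fun l => w l) = 0 ∧ ∀ l, σ j (w l) = σ j (v l) := by
  have h1 := (h.mem_iff j v).2 hv
  rw [← LinearMap.range_eq_top.2 h.surjective, ← Submodule.map_top, ← Submodule.map_smul''] at h1
  obtain ⟨u, hu, hDu⟩ := h1
  rw [SetLike.mem_coe, Ideal.mem_smul_top_pi_iff] at hu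
  refine ⟨fun l => v l - ⟨u l, Ideal.pow_le_pow_right j.le_succ (hu l)⟩, ?_, fun l => ?_⟩
  · rw [← sub_eq_zero, ← map_sub] at hDu
    rw [← neg_eq_zero, ← map_neg, ← hDu]
    congr 1
    ext l
    simp
  · rw [map_sub, sub_eq_self, hσ.eq_zero_iff]
    exact hu l

variable [IsLocalRing R] [IsNoetherianRing R]

/-- The inductive step of the lifting. Columns of `d'` are initial forms of elements of `ker D`, and
these elements define `D'`. Exactness gives successive approximation of kernel elements by values of
`D'`; Artin–Rees ends it after finitely many steps, so no completeness is required. -/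
theorem exists_lift_ker [GradedRing 𝒜] (hI : I = IsLocalRing.maximalIdeal R)
    (hσ : IsInitialForm 𝒜 σ) (h : IsLift σ d D)
    (hd : LinearMap.ker d ≤ (HomogeneousIdeal.irrelevant 𝒜).toIdeal • ⊤)
    {s : ℕ} {d' : (Fin s → A) →ₗ[A] (Fin r → A)} (hex : Function.Exact d' d)
    (hlin : ∀ l k, d' (Pi.single l 1) k ∈ 𝒜 1) :
    (∀ j, LinearMap.ker D ⊓ I ^ (j + 1) • ⊤ = I ^ j • LinearMap.ker D) ∧
      ∃ D' : (Fin s → R) →ₗ[R] ↥(LinearMap.ker D), IsLift σ d' D' := by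
  have hker := h.ker_le hσ hd
  have hκ (l : Fin s) : ∃ κ : Fin r → ↥(I ^ 1), D (fun k => κ k) = 0 ∧
      ∀ k, σ 1 (κ k) = d' (Pi.single l 1) k := by
    choose v hv using fun k => hσ.exists_eq (hlin l k)
    obtain ⟨w, hw, hwv⟩ := h.exists_mem_ker hσ v (by
      rw [funext hv]
      exact hex.apply_apply_eq_zero _)
    exact ⟨w, hw, fun k => (hwv k).trans (hv k)⟩
  choose κ hκ0 hκσ using hκ
  let D' : (Fin s → R) →ₗ[R] ↥(LinearMap.ker D) :=
    Fintype.linearCombination R fun l => ⟨fun k => κ l k, hκ0 l⟩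
  have hD' (w : Fin s → R) (k : Fin r) : (D' w : Fin r → R) k = ∑ l, w l * κ l k := by
    simp [D', Fintype.linearCombination_apply]
  -- `D'` raises the order by one, and on initial forms it is `d'`.
  have hsym (j : ℕ) (w : Fin s → ↥(I ^ j)) : ∃ z : Fin r → ↥(I ^ (j + 1)),
      (D' (fun l => w l) : Fin r → R) = (fun k => (z k : R)) ∧
        d' (fun l => σ j (w l)) = fun k => σ (j + 1) (z k) := by
    refine ⟨fun k => ∑ l, ⟨w l * κ l k, AssocGraded.mul_mem_pow (w l).2 (κ l k).2⟩, ?_, ?_⟩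
    · funext k
      rw [hD', AddSubmonoidClass.coe_finsetSum]
    · rw [d'.apply_eq_sum_single]
      funext k
      rw [Finset.sum_apply, map_sum]
      refine Finset.sum_congr rfl fun l _ => ?_
      rw [Pi.smul_apply, smul_eq_mul, ← hκσ, hσ.mul]
  -- The degree `j + 1` initial form of `x` is in `ker d = im d'`, hence comes from degree `j`.
  -- Subtracting the corresponding value of `D'` pushes `x` one layer deeper.
  have happrox (j : ℕ) (x : Fin r → R) (hx : x ∈ LinearMap.ker D)
      (hxj : x ∈ I ^ (j + 1) • (⊤ : Submodule R (Fin r → R))) :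
      ∃ w : Fin s → ↥(I ^ j),
        x - D' (fun l => w l) ∈ LinearMap.ker D ⊓ I ^ (j + 1 + 1) • ⊤ := by
    rw [Ideal.mem_smul_top_pi_iff] at hxj
    have hdx : d (fun k => σ (j + 1) ⟨x k, hxj k⟩) = 0 := by
      rw [← h.mem_iff]
      change D x ∈ _
      rw [LinearMap.mem_ker.1 hx]
      exact zero_mem _
    obtain ⟨v, hv⟩ := (hex _).1 hdx
    obtain ⟨w, hw⟩ := hσ.exists_preimage hlin v (fun k => congrFun hv k ▸ hσ.mem _)
    obtain ⟨z, hz, hzσ⟩ := hsym j w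
    refine ⟨w, Submodule.sub_mem _ hx (D' _).2, ?_⟩
    refine (Ideal.mem_smul_top_pi_iff _ _).2 fun k => ?_
    have hk := congrFun (hv.symm.trans (hw.symm.trans hzσ)) k
    rw [← sub_eq_zero, ← map_sub, hσ.eq_zero_iff] at hk
    rw [hz]
    exact hk
  have hD'mem (j : ℕ) (w : Fin s → ↥(I ^ j)) :
      (D' (fun l => w l) : Fin r → R) ∈ I ^ j • LinearMap.ker D := by
    rw [D'.apply_eq_sum_single, AddSubmonoidClass.coe_finsetSum]
    exact Submodule.sum_mem _ fun l _ => Submodule.smul_mem_smul (w l).2 (D' _).2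
  have hstep (j n : ℕ) : LinearMap.ker D ⊓ I ^ (j + 1) • ⊤ ≤
      I ^ j • LinearMap.ker D ⊔ LinearMap.ker D ⊓ I ^ (j + 1 + n) • ⊤ := by
    induction n with
    | zero => exact le_sup_right
    | succ n ih =>
      refine ih.trans (sup_le le_sup_left ?_)
      rintro x ⟨hx, hxj⟩
      obtain ⟨w, hw⟩ := happrox (j + n) x hx (by rwa [add_right_comm])
      rw [← add_sub_cancel (D' (fun l => w l) : Fin r → R) x]
      refine Submodule.add_mem_sup ?_ ?_
      · exact Submodule.smul_mono_left (Ideal.pow_le_pow_right (by omega)) (hD'mem _ w)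
      · convert hw using 4
        omega
  have hfil (j : ℕ) : LinearMap.ker D ⊓ I ^ (j + 1) • ⊤ = I ^ j • LinearMap.ker D := by
    apply le_antisymm
    -- With `k` the Artin–Rees constant, `k` approximation steps suffice: the remainder lies in
    -- `I^(j+1) ker D`, inside `I^j ker D`.
    · obtain ⟨k, hk⟩ := Ideal.exists_pow_inf_eq_pow_smul I (LinearMap.ker D)
      refine (hstep j k).trans (sup_le le_rfl ?_)
      rw [inf_comm, hk (j + 1 + k) (by omega)]
      refine (Submodule.smul_mono le_rfl inf_le_right).trans (Submodule.smul_mono_left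
        (Ideal.pow_le_pow_right (by omega)))
    · refine le_inf Submodule.smul_le_right ?_
      rw [pow_succ, mul_smul]
      exact Submodule.smul_mono le_rfl hker
  refine ⟨hfil, D', ?_, ?_⟩
  -- One approximation leaves a remainder in `ker D ∩ I² F = I ker D`; Nakayama then gives
  -- surjectivity.
  · have hle : LinearMap.ker D ≤ LinearMap.range ((LinearMap.ker D).subtype ∘ₗ D') := by
      refine Submodule.le_of_le_smul_of_le_jacobson_bot (I := I) (IsNoetherian.noetherian _)
        (hI ▸ IsLocalRing.maximalIdeal_le_jacobson _) ?_
      intro x hx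
      obtain ⟨w, hw⟩ := happrox 0 x hx (by simpa using hker hx)
      rw [hfil 1, pow_one] at hw
      rw [← add_sub_cancel (D' (fun l => w l) : Fin r → R) x]
      exact Submodule.add_mem_sup ⟨_, rfl⟩ hw
    intro x
    obtain ⟨w, hw⟩ := hle x.2
    exact ⟨w, Subtype.ext hw⟩
  · intro j w
    obtain ⟨z, hz, hzσ⟩ := hsym j w
    have h1 (y : ↥(LinearMap.ker D)) : y ∈ I ^ (j + 1) • (⊤ : Submodule R ↥(LinearMap.ker D)) ↔
        (y : Fin r → R) ∈ I ^ (j + 1) • LinearMap.ker D := by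
      have : I ^ (j + 1) • LinearMap.ker D =
          (I ^ (j + 1) • (⊤ : Submodule R ↥(LinearMap.ker D))).map (LinearMap.ker D).subtype := by
        rw [Submodule.map_smul'', Submodule.map_top, Submodule.range_subtype]
      rw [this]
      exact ((Submodule.injective_subtype _).mem_set_image).symm
    rw [h1, ← hfil, hzσ, Submodule.mem_inf, and_iff_right (D' _).2, Ideal.mem_smul_top_pi_iff, hz,
      funext_iff]
    exact forall_congr' fun k => (hσ.eq_zero_iff (z k)).symm

end IsLift

end Lift

/-! ## Hilbert series of syzygies -/

section Syzygy

variable {R : Type*} [CommRing R] [IsLocalRing R]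
  {N : Type*} [AddCommGroup N] [Module R N]

local notation "𝔪" => IsLocalRing.maximalIdeal R

theorem localHilbertSeries_congr {N' : Type*} [AddCommGroup N'] [Module R N'] (e : N ≃ₗ[R] N') :
    localHilbertSeries R N = localHilbertSeries R N' := by
  have hm (j : ℕ) : (𝔪 ^ j • (⊤ : Submodule R N)).map e.toLinearMap = 𝔪 ^ j • ⊤ := by
    rw [Submodule.map_smul'', Submodule.map_top, LinearEquiv.range]
  ext j
  simp only [localHilbertSeries, subquotientSeries, PowerSeries.coeff_mk]
  rw [← hm j, ← subquotientLength_comap, ← hm, Submodule.comap_map_eq_of_injective e.injective]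

theorem subquotientLength_pow_smul_pi (r j : ℕ) :
    subquotientLength (𝔪 ^ (j + 1) • (⊤ : Submodule R (Fin r → R))) (𝔪 ^ j • ⊤) =
      r * subquotientLength (𝔪 ^ (j + 1) • (⊤ : Submodule R R)) (𝔪 ^ j • ⊤) := by
  have h (J : Ideal R) : J • (⊤ : Submodule R (Fin r → R)) =
      Submodule.pi Set.univ fun _ => J • (⊤ : Submodule R R) := by
    ext w
    rw [Ideal.mem_smul_top_pi_iff, Submodule.mem_pi]
    simp
  rw [h, h, subquotientLength_pi]

variable [IsNoetherianRing R]

theorem subquotientLength_pow_smul_ne_top {X : Type*} [AddCommGroup X] [Module R X]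
    [Module.Finite R X] (j : ℕ) :
    subquotientLength (𝔪 ^ (j + 1) • (⊤ : Submodule R X)) (𝔪 ^ j • ⊤) ≠ ⊤ :=
  subquotientLength_ne_top (IsNoetherian.noetherian _) (by rw [← mul_smul, pow_succ'])

/-- In positive degree the modular law splits a layer of `F` into the corresponding layer of `N` and
a layer of `ker D`, which `hfil` identifies with a power layer of index one lower. In degree 0
minimality gives `N / mN = F / mF`. -/
theorem localHilbertSeries_eq_sub {r : ℕ} {D : (Fin r → R) →ₗ[R] N}
    (hD : Function.Surjective D) (hker : LinearMap.ker D ≤ 𝔪 • ⊤)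
    (hfil : ∀ j, LinearMap.ker D ⊓ 𝔪 ^ (j + 1) • ⊤ = 𝔪 ^ j • LinearMap.ker D) :
    localHilbertSeries R N = PowerSeries.C (r : ℤ) * localHilbertSeries R R -
      PowerSeries.X * localHilbertSeries R ↥(LinearMap.ker D) := by
  have : Module.Finite R N := Module.Finite.of_surjective D hD
  have hm (j : ℕ) : (𝔪 ^ j • (⊤ : Submodule R (Fin r → R))).map D = 𝔪 ^ j • ⊤ := by
    rw [Submodule.map_smul'', Submodule.map_top, LinearMap.range_eq_top.2 hD]
  have hc (j : ℕ) : (𝔪 ^ j • (⊤ : Submodule R N)).comap D = 𝔪 ^ j • ⊤ ⊔ LinearMap.ker D := by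
    rw [← hm, Submodule.comap_map_eq]
  rw [eq_sub_iff_add_eq]
  ext j
  rw [map_add, PowerSeries.coeff_C_mul]
  cases j with
  | zero =>
    rw [PowerSeries.coeff_zero_X_mul, add_zero]
    simp only [localHilbertSeries, subquotientSeries, PowerSeries.coeff_mk]
    rw [← hm 0, ← subquotientLength_comap, hc, zero_add, pow_one, sup_eq_left.2 hker]
    have := subquotientLength_pow_smul_pi (R := R) r 0
    rw [zero_add, pow_one] at this
    rw [this, ENat.toNat_mul]
    simp
  | succ j =>
    rw [PowerSeries.coeff_succ_X_mul]
    simp only [localHilbertSeries, subquotientSeries, PowerSeries.coeff_mk]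
    have key := subquotientLength_modular (R := R) (X := Fin r → R)
      (B := 𝔪 ^ (j + 1 + 1) • ⊤) (T := 𝔪 ^ (j + 1) • ⊤)
      (Submodule.smul_mono_left (Ideal.pow_le_pow_right (Nat.le_succ _))) (LinearMap.ker D)
    have hs (i : ℕ) : (𝔪 ^ i • (⊤ : Submodule R ↥(LinearMap.ker D))).map
        (LinearMap.ker D).subtype = 𝔪 ^ i • LinearMap.ker D := by
      rw [Submodule.map_smul'', Submodule.map_top, Submodule.range_subtype]
    rw [← hc, inf_comm, hfil, inf_comm, hfil, subquotientLength_comap, Submodule.map_sup, hm,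
      (LinearMap.le_ker_iff_map (f := D)).1 le_rfl, sup_bot_eq, ← hs, ← hs,
      ← subquotientLength_comap, Submodule.comap_map_eq_of_injective (Submodule.injective_subtype _),
      subquotientLength_pow_smul_pi] at key
    have key' := congrArg ENat.toNat key
    rw [ENat.toNat_mul, ENat.toNat_add (subquotientLength_pow_smul_ne_top j)
      (subquotientLength_pow_smul_ne_top (j + 1))] at key'
    rw [ENat.toNat_natCast] at key'
    rw [add_comm]
    exact_mod_cast key'.symm

/-- Minimal covers by free modules are unique. -/
theorem exists_linearEquiv_of_minimal_covers {b r : ℕ} {p : (Fin b → R) →ₗ[R] N}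
    {D : (Fin r → R) →ₗ[R] N} (hp : Function.Surjective p) (hD : Function.Surjective D)
    (hpk : LinearMap.ker p ≤ 𝔪 • ⊤) (hDk : LinearMap.ker D ≤ 𝔪 • ⊤) :
    ∃ e : (Fin b → R) ≃ₗ[R] (Fin r → R), D ∘ₗ e.toLinearMap = p := by
  -- By Nakayama, a factorization of a surjection through a minimal cover is itself surjective.
  -- Applied both ways, it makes `ψ ∘ φ` a surjective, hence injective, endomorphism.
  have key {a c : ℕ} {f : (Fin a → R) →ₗ[R] N} {g : (Fin c → R) →ₗ[R] N}
      (hf : Function.Surjective f) (hgk : LinearMap.ker g ≤ 𝔪 • ⊤)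
      (φ : (Fin a → R) →ₗ[R] (Fin c → R)) (h : g ∘ₗ φ = f) : Function.Surjective φ := by
    rw [← LinearMap.range_eq_top, ← top_le_iff]
    refine Submodule.le_of_le_smul_of_le_jacobson_bot (I := 𝔪) (IsNoetherian.noetherian _)
      (IsLocalRing.maximalIdeal_le_jacobson _) ?_
    intro x _
    obtain ⟨y, hy⟩ := hf (g x)
    rw [← add_sub_cancel (φ y) x]
    refine Submodule.add_mem_sup ⟨y, rfl⟩ (hgk ?_)
    rw [LinearMap.mem_ker, map_sub, ← hy, ← h, LinearMap.comp_apply, sub_self]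
  obtain ⟨φ, hφ⟩ := Module.projective_lifting_property D p hD
  obtain ⟨ψ, hψ⟩ := Module.projective_lifting_property p D hp
  have hφs := key hp hDk φ hφ
  have hψs := key hD hpk ψ hψ
  have hinj : Function.Injective (ψ ∘ₗ φ) :=
    OrzechProperty.injective_of_surjective_endomorphism _ (hψs.comp hφs)
  exact ⟨LinearEquiv.ofBijective φ ⟨Function.Injective.of_comp (f := ψ) hinj, hφs⟩, hφ⟩

variable {A : Type*} [CommRing A] {𝒜 : ℕ → AddSubgroup A} [GradedRing 𝒜]
  {σ : ∀ j : ℕ, ↥(IsLocalRing.maximalIdeal R ^ j) →+ A}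
  {Q : Type*} [AddCommGroup Q] [Module A Q]

/-- Transports the lifting step from `D` to any minimal cover `p`, so that the induction can follow
the fixed resolution defining the Betti numbers. `K` is a variable because its identification with a
syzygy of that resolution is a proved equality. -/
theorem IsLift.exists_lift_syzygy (hσ : IsInitialForm 𝒜 σ) {r : ℕ} {d : (Fin r → A) →ₗ[A] Q}
    {D : (Fin r → R) →ₗ[R] N} (h : IsLift σ d D)
    (hd : LinearMap.ker d ≤ (HomogeneousIdeal.irrelevant 𝒜).toIdeal • ⊤)
    {s : ℕ} {d' : (Fin s → A) →ₗ[A] (Fin r → A)} (hex : Function.Exact d' d)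
    (hlin : ∀ l k, d' (Pi.single l 1) k ∈ 𝒜 1)
    {b : ℕ} {p : (Fin b → R) →ₗ[R] N} (hp : Function.Surjective p)
    {K : Submodule R (Fin b → R)} (hK : LinearMap.ker p = K) (hpk : K ≤ 𝔪 • ⊤) :
    (∃ D' : (Fin s → R) →ₗ[R] ↥K, IsLift σ d' D') ∧
      localHilbertSeries R N = PowerSeries.C (b : ℤ) * localHilbertSeries R R -
        PowerSeries.X * localHilbertSeries R ↥K := by
  subst hK
  have hDk := h.ker_le hσ hd
  obtain ⟨hfil, D', hD'⟩ := h.exists_lift_ker rfl hσ hd hex hlin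
  obtain ⟨e, he⟩ := exists_linearEquiv_of_minimal_covers hp h.surjective hpk hDk
  have hbr : b = r := by simpa using e.finrank_eq
  have hmap : (LinearMap.ker D).map e.symm.toLinearMap = LinearMap.ker p := by
    rw [← he, LinearMap.ker_comp]
    exact (LinearMap.ker D).map_equiv_eq_comap_symm e.symm
  let ε : ↥(LinearMap.ker D) ≃ₗ[R] ↥(LinearMap.ker p) :=
    (e.symm.submoduleMap (LinearMap.ker D)).trans (LinearEquiv.ofEq _ _ hmap)
  refine ⟨⟨_, hD'.comp_linearEquiv ε⟩, ?_⟩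
  rw [← localHilbertSeries_congr ε, hbr]
  exact localHilbertSeries_eq_sub h.surjective hDk hfil

end Syzygy

/-! ## Syzygies -/

namespace MinimalFreeResolution

variable {R : Type u} [CommRing R] {I : Ideal R} {M : Type v} [AddCommGroup M] [Module R M]
  (P : MinimalFreeResolution I M)

/-- The kernel of the map out of the free module in homological degree `i`. -/
def syzygy : ∀ i, Submodule R (Fin (P.rank i) → R)
  | 0 => LinearMap.ker P.aug
  | i + 1 => LinearMap.ker (P.d i)

theorem syzygy_le (i : ℕ) : P.syzygy i ≤ I • ⊤ := by
  cases i
  exacts [P.ker_aug_le, P.ker_d_le _]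

theorem range_d (i : ℕ) : LinearMap.range (P.d i) = P.syzygy i := by
  cases i
  exacts [(LinearMap.exact_iff.1 P.exact_aug).symm, (LinearMap.exact_iff.1 (P.exact_d _)).symm]

/-- The cover of a syzygy given by the differential. -/
def toSyzygy (i : ℕ) : (Fin (P.rank (i + 1)) → R) →ₗ[R] ↥(P.syzygy i) :=
  (P.d i).codRestrict (P.syzygy i) fun w => (P.range_d i).le (LinearMap.mem_range_self _ w)

theorem toSyzygy_surjective (i : ℕ) : Function.Surjective (P.toSyzygy i) := by
  rintro ⟨x, hx⟩
  obtain ⟨w, hw⟩ := (P.range_d i).ge hx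
  exact ⟨w, Subtype.ext hw⟩

theorem ker_toSyzygy (i : ℕ) : LinearMap.ker (P.toSyzygy i) = P.syzygy (i + 1) :=
  LinearMap.ker_codRestrict _ _ _

end MinimalFreeResolution

/-! ## Rationality of the Poincaré series -/

section Poincare

/-- The sign-twisted tails `P i` of `b` obey the same recurrence with `G` replaced by 1. So `h i - G
* P i` equals `-X` times the next such difference, and is divisible by every power of `X`. -/
theorem PowerSeries.mul_evalNegHom_eq {G : PowerSeries ℤ} {h : ℕ → PowerSeries ℤ} {b : ℕ → ℤ}
    (hb : ∀ i, h i = PowerSeries.C (b i) * G - PowerSeries.X * h (i + 1)) :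
    G * PowerSeries.evalNegHom (PowerSeries.mk b) = h 0 := by
  let P : ℕ → PowerSeries ℤ := fun i => PowerSeries.evalNegHom (PowerSeries.mk fun k => b (i + k))
  have hP (i) : P i = PowerSeries.C (b i) - PowerSeries.X * P (i + 1) := by
    ext n
    cases n with
    | zero => simp [P, PowerSeries.evalNegHom, PowerSeries.coeff_rescale]
    | succ n =>
      rw [map_sub, PowerSeries.coeff_C, if_neg n.succ_ne_zero]
      simp [P, PowerSeries.evalNegHom, PowerSeries.coeff_rescale, PowerSeries.coeff_succ_X_mul,
        pow_succ, add_assoc, add_comm 1]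
  have hE (n : ℕ) : ∀ i, PowerSeries.coeff n (h i - G * P i) = 0 := by
    induction n with
    | zero =>
      intro i
      rw [hb, hP]
      simp [mul_comm]
    | succ n ih =>
      intro i
      have : h i - G * P i = -(PowerSeries.X * (h (i + 1) - G * P (i + 1))) := by
        rw [hb, hP]
        ring
      rw [this, map_neg, PowerSeries.coeff_succ_X_mul, ih, neg_zero]
  have h0 : h 0 - G * P 0 = 0 := by
    ext n
    rw [hE, map_zero]
  rw [sub_eq_zero] at h0
  rw [h0]
  simp [P]

variable {R : Type u} [CommRing R] [IsLocalRing R] [IsNoetherianRing R]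

local notation "𝔪" => IsLocalRing.maximalIdeal R

variable {A : Type*} [CommRing A] {𝒜 : ℕ → AddSubgroup A} [GradedRing 𝒜]
  {σ : ∀ j : ℕ, ↥(IsLocalRing.maximalIdeal R ^ j) →+ A}
  {Q : Type*} [AddCommGroup Q] [Module A Q]

theorem localHilbertSeries_self_ne_zero : localHilbertSeries R R ≠ 0 := by
  intro h
  have h0 := congrArg (PowerSeries.coeff 0) h
  simp only [localHilbertSeries, subquotientSeries, PowerSeries.coeff_mk, map_zero,
    Nat.cast_eq_zero, ENat.toNat_eq_zero, subquotientLength_pow_smul_ne_top, or_false] at h0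
  rw [subquotientLength, Module.length_eq_zero_iff, Submodule.subsingleton_iff_eq_bot,
    ← LinearMap.le_ker_iff_map, Submodule.ker_mkQ] at h0
  have h1 : (1 : R) ∈ 𝔪 := by
    have : (1 : R) ∈ 𝔪 ^ 0 • (⊤ : Submodule R R) := by simp
    simpa using h0 this
  exact (Ideal.ne_top_iff_one _).1 (IsLocalRing.maximalIdeal.isMaximal R).ne_top h1

/-- If the augmentation of a linear resolution over the associated graded ring lifts to a cover
of `N`, then the Poincaré series of `N` is rational. -/
theorem isRational_poincareSeries_of_isLift (hσ : IsInitialForm 𝒜 σ) {N : Type v} [AddCommGroup N]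
    [Module R N] [Module.Finite R N]
    (F : MinimalFreeResolution (HomogeneousIdeal.irrelevant 𝒜).toIdeal Q)
    (hlin : ∀ i l k, F.d i (Pi.single l 1) k ∈ 𝒜 1)
    {D : (Fin (F.rank 0) → R) →ₗ[R] N} (hD : IsLift σ F.aug D) :
    (poincareSeries R N).IsRational := by
  let P : MinimalFreeResolution 𝔪 N := (MinimalFreeResolution.nonempty (R := R) N).some
  have h₀ := hD.exists_lift_syzygy hσ F.ker_aug_le F.exact_aug (hlin 0) P.aug_surjective
    (K := P.syzygy 0) rfl (P.syzygy_le 0)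
  have hlift (i : ℕ) : ∃ D' : (Fin (F.rank (i + 1)) → R) →ₗ[R] ↥(P.syzygy i), IsLift σ (F.d i) D' := by
    induction i with
    | zero => exact h₀.1
    | succ i ih =>
      obtain ⟨D', hD'⟩ := ih
      exact (hD'.exists_lift_syzygy hσ (F.ker_d_le i) (F.exact_d i) (hlin (i + 1)) (P.toSyzygy_surjective i)
        (P.ker_toSyzygy i) (P.syzygy_le (i + 1))).1
  have hseries (i : ℕ) : localHilbertSeries R ↥(P.syzygy i) =
      PowerSeries.C (P.rank (i + 1) : ℤ) * localHilbertSeries R R -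
        PowerSeries.X * localHilbertSeries R ↥(P.syzygy (i + 1)) := by
    obtain ⟨D', hD'⟩ := hlift i
    exact (hD'.exists_lift_syzygy hσ (F.ker_d_le i) (F.exact_d i) (hlin (i + 1)) (P.toSyzygy_surjective i)
      (P.ker_toSyzygy i) (P.syzygy_le (i + 1))).2
  -- Since `P.syzygy i` sits inside the `i`-th free module, it is the entry of index `i + 1`; index
  -- 0 is `N` itself.
  have hmul := PowerSeries.mul_evalNegHom_eq (G := localHilbertSeries R R)
    (h := fun i => Nat.casesOn i (localHilbertSeries R N) fun i => localHilbertSeries R ↥(P.syzygy i))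
    (b := fun i => (P.rank i : ℤ)) (by
      intro i
      cases i
      exacts [h₀.2, hseries _])
  have hrat := (PowerSeries.IsRational.of_mul_eq (isRational_localHilbertSeries R R)
    (isRational_localHilbertSeries R N) localHilbertSeries_self_ne_zero hmul).evalNegHom
  have : PowerSeries.evalNegHom (PowerSeries.evalNegHom (PowerSeries.mk fun i => (P.rank i : ℤ))) =
      PowerSeries.mk fun i => (P.rank i : ℤ) := by
    rw [PowerSeries.evalNegHom, PowerSeries.rescale_rescale]
    simp
  rwa [this] at hrat

end Poincare

/-! ## Linear resolutions of the associated graded module and of the residue field -/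

section Graded

variable {A : Type*} [CommRing A] {𝒜 : ℕ → AddSubgroup A} [GradedRing 𝒜]
  {M : Type*} [AddCommGroup M] [Module A M] {ℳ : ℕ → AddSubgroup M}

theorem GradedMinimalFreeResolution.single_mem_freeGrading {n : ℕ} (deg : Fin n → ℕ) (l : Fin n) :
    (Pi.single l 1 : Fin n → A) ∈ freeGrading 𝒜 deg (deg l) := by
  intro k
  by_cases hk : k = l
  · subst hk
    simpa using SetLike.GradedOne.one_mem (A := 𝒜)
  · rw [Pi.single_eq_of_ne hk]
    split_ifs
    exacts [zero_mem _, rfl]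

theorem GradedMinimalFreeResolution.deg_eq (F : GradedMinimalFreeResolution 𝒜 ℳ) {δ₀ : ℕ}
    (hF : ∀ i j, F.gradedBetti i j ≠ 0 → j = δ₀ + i) (i : ℕ) (l : Fin (F.rank i)) :
    F.deg i l = δ₀ + i := by
  refine hF i _ (Finset.card_ne_zero_of_mem (a := l) ?_)
  simp

/-- Linearity in the form used by the lifting: basis degrees of source and target differ by exactly
one. -/
theorem GradedMinimalFreeResolution.d_single_mem (F : GradedMinimalFreeResolution 𝒜 ℳ) {δ₀ : ℕ}
    (hF : ∀ i j, F.gradedBetti i j ≠ 0 → j = δ₀ + i) (i : ℕ) (l : Fin (F.rank (i + 1)))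
    (k : Fin (F.rank i)) : F.d i (Pi.single l 1) k ∈ 𝒜 1 := by
  have h := F.d_graded i _ _ (single_mem_freeGrading (F.deg (i + 1)) l) k
  rw [F.deg_eq hF, F.deg_eq hF, if_pos (by omega)] at h
  convert h using 2
  omega

theorem GradedMinimalFreeResolution.aug_single_mem (F : GradedMinimalFreeResolution 𝒜 ℳ) {δ₀ : ℕ}
    (hF : ∀ i j, F.gradedBetti i j ≠ 0 → j = δ₀ + i) (l : Fin (F.rank 0)) :
    F.aug (Pi.single l 1) ∈ ℳ δ₀ := by
  have h := F.aug_graded _ _ (single_mem_freeGrading (F.deg 0) l)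
  rwa [F.deg_eq hF, add_zero] at h

/-- Degrees are natural numbers, so a component of `a` of positive degree cannot contribute in
degree 0. -/
theorem decompose_zero_smul [DirectSum.Decomposition ℳ] [SetLike.GradedSMul 𝒜 ℳ] (a : A) {k : ℕ}
    {y : M} (hy : y ∈ ℳ k) :
    DirectSum.decompose ℳ (a • y) 0 =
      DirectSum.decompose ℳ ((DirectSum.decompose 𝒜 a 0 : A) • y) 0 := by
  induction a using DirectSum.Decomposition.inductionOn 𝒜 with
  | zero => simp
  | add a b ha hb =>
    simp only [add_smul, DirectSum.decompose_add, DirectSum.add_apply, AddSubgroup.coe_add, ha, hb]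
  | @homogeneous i a =>
    by_cases hi : i = 0
    · subst hi
      rw [DirectSum.decompose_of_mem_same _ a.2]
    · have ha : (a : A) • y ∈ ℳ (i + k) := SetLike.GradedSMul.smul_mem a.2 hy
      apply Subtype.ext
      rw [DirectSum.decompose_of_mem_ne _ a.2 hi, zero_smul, DirectSum.decompose_of_mem_ne _ ha
        (by omega)]
      simp

end Graded

/-! ### Lifting the augmentations onto `M` and onto the residue field -/

section ModuleCase

/-- The maps `τ j : I ^ j M → Q` exhibit the graded module `Q` as the associated graded module
of `M` with respect to the ideal `I`, over the associated graded ring given by `σ`. -/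
structure IsModuleInitialForm {R : Type*} [CommRing R] {I : Ideal R} {M : Type*} [AddCommGroup M]
    [Module R M] {A : Type*} [CommRing A] (σ : ∀ j, ↥(I ^ j) →+ A) {Q : Type*} [AddCommGroup Q]
    [Module A Q] (ℳ : ℕ → AddSubgroup Q)
    (τ : ∀ j, ↥(I ^ j • (⊤ : Submodule R M)) →+ Q) : Prop where
  eq_zero_iff : ∀ {j : ℕ} (x : ↥(I ^ j • (⊤ : Submodule R M))),
    τ j x = 0 ↔ (x : M) ∈ I ^ (j + 1) • (⊤ : Submodule R M)
  mem : ∀ {j : ℕ} (x : ↥(I ^ j • (⊤ : Submodule R M))), τ j x ∈ ℳ j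
  exists_eq : ∀ {j : ℕ} {y : Q}, y ∈ ℳ j → ∃ x, τ j x = y
  smul : ∀ {i j : ℕ} (a : ↥(I ^ i)) (x : ↥(I ^ j • (⊤ : Submodule R M))),
    σ i a • τ j x = τ (i + j) ⟨(a : R) • (x : M), AssocGraded.smul_mem_pow a.2 x.2⟩

/-- The initial form in degree `j` of an element of `I ^ j M`. -/
noncomputable def moduleInitialForm {R : Type*} [CommRing R] (I : Ideal R) (M : Type*)
    [AddCommGroup M] [Module R M] (j : ℕ) :
    ↥(I ^ j • (⊤ : Submodule R M)) →+ AssocGradedModule I M :=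
  (DirectSum.of (AssocGraded.ModPiece I M) j).comp
    (Submodule.mkQ (Submodule.submoduleOf (I ^ (j + 1) • (⊤ : Submodule R M))
      (I ^ j • (⊤ : Submodule R M)))).toAddMonoidHom

theorem isModuleInitialForm_moduleInitialForm {R : Type*} [CommRing R] (I : Ideal R) (M : Type*)
    [AddCommGroup M] [Module R M] :
    IsModuleInitialForm (A := AssocGradedRing I) (Q := AssocGradedModule I M) (initialForm I)
      (assocGradedModuleGrading I M) (moduleInitialForm I M) where
  eq_zero_iff {j} x := by
    change DirectSum.of (AssocGraded.ModPiece I M) j (AssocGraded.modMk j x.1 x.2) = 0 ↔ _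
    rw [← map_zero (DirectSum.of (AssocGraded.ModPiece I M) j), (DirectSum.of_injective j).eq_iff]
    exact Submodule.Quotient.mk_eq_zero _
  mem x := ⟨_, rfl⟩
  exists_eq := by
    rintro j _ ⟨x, rfl⟩
    induction x using AssocGraded.modPiece_ind with
    | h x hx => exact ⟨⟨x, hx⟩, rfl⟩
  smul a x := DirectSum.Gmodule.of_smul_of _ _ _ _

variable {R : Type*} [CommRing R] [IsLocalRing R] {M : Type*} [AddCommGroup M] [Module R M]
  [Module.Finite R M] {A : Type*} [CommRing A] {𝒜 : ℕ → AddSubgroup A} [GradedRing 𝒜]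
  {σ : ∀ j : ℕ, ↥(IsLocalRing.maximalIdeal R ^ j) →+ A}

theorem Submodule.eq_top_of_forall_exists_sub_mem_maximalIdeal_smul {S : Submodule R M}
    (h : ∀ x, ∃ y ∈ S, x - y ∈ IsLocalRing.maximalIdeal R • (⊤ : Submodule R M)) : S = ⊤ := by
  rw [← top_le_iff]
  refine Submodule.le_of_le_smul_of_le_jacobson_bot (I := IsLocalRing.maximalIdeal R)
    Module.Finite.fg_top (IsLocalRing.maximalIdeal_le_jacobson _) fun x _ => ?_
  obtain ⟨y, hy, hxy⟩ := h x
  rw [← add_sub_cancel y x]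
  exact Submodule.add_mem_sup hy hxy

/-- The degree 0 part `M / mM` decides: either `δ₀ = 0` and lifts of the generators define `D`, or
that part vanishes and `M = 0` by Nakayama. -/
theorem exists_isLift_of_isModuleInitialForm (hσ : IsInitialForm 𝒜 σ) {Q : Type*} [AddCommGroup Q]
    [Module A Q] {ℳ : ℕ → AddSubgroup Q} [DirectSum.Decomposition ℳ] [SetLike.GradedSMul 𝒜 ℳ]
    {τ : ∀ j : ℕ, ↥(IsLocalRing.maximalIdeal R ^ j • (⊤ : Submodule R M)) →+ Q}
    (hτ : IsModuleInitialForm σ ℳ τ) {r : ℕ} {d : (Fin r → A) →ₗ[A] Q}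
    (hd : Function.Surjective d) {δ₀ : ℕ} (hδ : ∀ l, d (Pi.single l 1) ∈ ℳ δ₀) :
    ∃ D : (Fin r → R) →ₗ[R] M, IsLift σ d D := by
  have hmem (w : Fin r → ↥(IsLocalRing.maximalIdeal R ^ 0)) : d (fun l => σ 0 (w l)) ∈ ℳ δ₀ := by
    rw [d.apply_eq_sum_single]
    refine sum_mem fun l _ => ?_
    have := SetLike.GradedSMul.smul_mem (hσ.mem (w l)) (hδ l)
    rwa [vadd_eq_add, zero_add] at this
  have hzero (x : M) : ∃ w : Fin r → ↥(IsLocalRing.maximalIdeal R ^ 0),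
      τ 0 ⟨x, by simp⟩ = DirectSum.decompose ℳ (d fun l => σ 0 (w l)) 0 := by
    obtain ⟨v, hv⟩ := hd (τ 0 ⟨x, by simp⟩)
    choose w hw using fun l => hσ.exists_eq (DirectSum.decompose 𝒜 (v l) 0).2
    refine ⟨w, ?_⟩
    rw [← DirectSum.decompose_of_mem_same ℳ (hτ.mem _), ← hv, d.apply_eq_sum_single v,
      d.apply_eq_sum_single, DirectSum.decompose_sum, DirectSum.decompose_sum,
      DFinsupp.finsetSum_apply, DFinsupp.finsetSum_apply]
    congr 1
    refine Finset.sum_congr rfl fun l _ => ?_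
    rw [hw, decompose_zero_smul (𝒜 := 𝒜) _ (hδ l)]
  by_cases h0 : δ₀ = 0
  · subst h0
    choose x hx using fun l => hτ.exists_eq (hδ l)
    let D : (Fin r → R) →ₗ[R] M := Fintype.linearCombination R fun l => (x l : M)
    have hD (w : Fin r → R) : D w = ∑ l, w l • (x l : M) := Fintype.linearCombination_apply _ _ _
    have hsym (j : ℕ) (w : Fin r → ↥(IsLocalRing.maximalIdeal R ^ j)) :
        ∃ z : ↥(IsLocalRing.maximalIdeal R ^ j • (⊤ : Submodule R M)),
          D (fun l => w l) = z ∧ d (fun l => σ j (w l)) = τ j z := by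
      have hcast {i : ℕ} (hi : i = j) {y : M}
          (hy : y ∈ IsLocalRing.maximalIdeal R ^ i • (⊤ : Submodule R M))
          (hy' : y ∈ IsLocalRing.maximalIdeal R ^ j • (⊤ : Submodule R M)) :
          τ i ⟨y, hy⟩ = τ j ⟨y, hy'⟩ := by
        subst hi
        rfl
      refine ⟨∑ l, ⟨(w l : R) • (x l : M), Submodule.smul_mem_smul (w l).2 trivial⟩, ?_, ?_⟩
      · rw [hD, AddSubmonoidClass.coe_finsetSum]
      · rw [d.apply_eq_sum_single, map_sum]
        refine Finset.sum_congr rfl fun l _ => ?_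
        rw [← hx, hτ.smul]
        exact hcast (add_zero j) _ _
    refine ⟨D, ?_, fun j w => ?_⟩
    · rw [← LinearMap.range_eq_top]
      refine Submodule.eq_top_of_forall_exists_sub_mem_maximalIdeal_smul fun y => ?_
      obtain ⟨w, hw⟩ := hzero y
      obtain ⟨z, hz, hzτ⟩ := hsym 0 w
      refine ⟨D fun l => w l, LinearMap.mem_range_self _ _, ?_⟩
      rw [DirectSum.decompose_of_mem_same ℳ (hmem w), hzτ, ← sub_eq_zero, ← map_sub,
        hτ.eq_zero_iff, zero_add, pow_one] at hw
      rw [hz]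
      exact hw
    · obtain ⟨z, hz, hzτ⟩ := hsym j w
      rw [hz, hzτ, hτ.eq_zero_iff]
  -- Generators of degree `δ₀ > 0` produce nothing in degree 0, so every element of `M` lies in
  -- `mM`.
  · have hbot : (⊥ : Submodule R M) = ⊤ := by
      refine Submodule.eq_top_of_forall_exists_sub_mem_maximalIdeal_smul fun y => ⟨0, zero_mem _, ?_⟩
      obtain ⟨w, hw⟩ := hzero y
      rw [DirectSum.decompose_of_mem_ne ℳ (hmem w) h0, hτ.eq_zero_iff, zero_add, pow_one] at hw
      rwa [sub_zero]
    have hM : Subsingleton M := (Submodule.subsingleton_iff R).1 (subsingleton_of_bot_eq_top hbot)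
    have hQ (y : Q) : y = 0 := by
      classical
      rw [← DirectSum.sum_support_decompose ℳ y]
      refine Finset.sum_eq_zero fun j _ => ?_
      obtain ⟨x, hx⟩ := hτ.exists_eq (DirectSum.decompose ℳ y j).2
      rw [← hx, Subsingleton.elim x 0, map_zero]
    refine ⟨0, fun y => ⟨0, Subsingleton.elim _ _⟩, fun j w => iff_of_true ?_ (hQ _)⟩
    rw [LinearMap.zero_apply]
    exact zero_mem _

/-- The quotient `A / A₊` sees only degree 0 initial forms modulo `m`, so choosing representatives
in `R` of the images of the basis vectors defines `D`. No degree condition on the generators is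
needed. -/
theorem exists_isLift_residueField (hσ : IsInitialForm 𝒜 σ) {r : ℕ}
    {d : (Fin r → A) →ₗ[A] A ⧸ (HomogeneousIdeal.irrelevant 𝒜).toIdeal}
    (hd : Function.Surjective d) :
    ∃ D : (Fin r → R) →ₗ[R] IsLocalRing.ResidueField R, IsLift σ d D := by
  let J : Ideal A := (HomogeneousIdeal.irrelevant 𝒜).toIdeal
  have hmk (y : A ⧸ J) : ∃ a : ↥(IsLocalRing.maximalIdeal R ^ 0),
      Ideal.Quotient.mk J (σ 0 a) = y := by
    obtain ⟨b, rfl⟩ := Ideal.Quotient.mk_surjective y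
    obtain ⟨a, ha⟩ := hσ.exists_eq (DirectSum.decompose 𝒜 b 0).2
    refine ⟨a, ?_⟩
    rw [ha, Ideal.Quotient.eq]
    change _ ∈ HomogeneousIdeal.irrelevant 𝒜
    rw [HomogeneousIdeal.mem_irrelevant_iff, map_sub, GradedRing.proj_apply, GradedRing.proj_apply,
      DirectSum.decompose_of_mem_same _ (DirectSum.decompose 𝒜 b 0).2, sub_self]
  choose x hx using fun l => hmk (d (Pi.single l 1))
  let D : (Fin r → R) →ₗ[R] IsLocalRing.ResidueField R :=
    Fintype.linearCombination R fun l => IsLocalRing.residue R (x l)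
  have hD (w : Fin r → R) : D w = IsLocalRing.residue R (∑ l, w l * x l) := by
    rw [map_sum]
    simp only [map_mul]
    exact Fintype.linearCombination_apply _ _ _
  have hdσ (w : Fin r → ↥(IsLocalRing.maximalIdeal R ^ 0)) : d (fun l => σ 0 (w l)) =
      Ideal.Quotient.mk J (σ 0 ⟨∑ l, w l * x l, AssocGraded.mem_pow_zero _⟩) := by
    have : (⟨∑ l, w l * x l, AssocGraded.mem_pow_zero _⟩ : ↥(IsLocalRing.maximalIdeal R ^ 0)) =
        ∑ l, ⟨w l * x l, AssocGraded.mem_pow_zero _⟩ := by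
      apply Subtype.ext
      rw [AddSubmonoidClass.coe_finsetSum]
    rw [this, d.apply_eq_sum_single, map_sum, map_sum]
    refine Finset.sum_congr rfl fun l _ => ?_
    rw [← hx]
    exact congrArg (Ideal.Quotient.mk J) (hσ.mul (w l) (x l))
  have hbot : IsLocalRing.maximalIdeal R • (⊤ : Submodule R (IsLocalRing.ResidueField R)) = ⊥ := by
    rw [eq_bot_iff, Submodule.smul_le]
    intro a ha y _
    rw [Submodule.mem_bot, Algebra.smul_def]
    change IsLocalRing.residue R a * y = 0
    rw [(IsLocalRing.residue_eq_zero_iff a).2 ha, zero_mul]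
  refine ⟨D, fun y => ?_, fun j w => ?_⟩
  · obtain ⟨y, rfl⟩ := IsLocalRing.residue_surjective y
    obtain ⟨v, hv⟩ := hd (Ideal.Quotient.mk J (σ 0 ⟨y, AssocGraded.mem_pow_zero _⟩))
    choose w hw using fun l => hmk (Ideal.Quotient.mk J (v l))
    refine ⟨fun l => w l, ?_⟩
    have h : d (fun l => σ 0 (w l)) = d v := by
      rw [d.apply_eq_sum_single, d.apply_eq_sum_single v]
      refine Finset.sum_congr rfl fun l _ => ?_
      rw [← hx]
      change Ideal.Quotient.mk J (σ 0 (w l)) * Ideal.Quotient.mk J (σ 0 (x l)) =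
        Ideal.Quotient.mk J (v l) * Ideal.Quotient.mk J (σ 0 (x l))
      rw [hw]
    rw [hdσ, hv, Ideal.Quotient.eq, ← map_sub, hσ.mem_irrelevant_iff] at h
    rw [hD, ← sub_eq_zero, ← map_sub, IsLocalRing.residue_eq_zero_iff]
    exact h
  · cases j with
    | zero =>
      rw [zero_add, pow_one, hbot, Submodule.mem_bot, hD, IsLocalRing.residue_eq_zero_iff, hdσ,
        Ideal.Quotient.eq_zero_iff_mem, hσ.mem_irrelevant_iff]
    -- Both sides hold automatically: the entries of `w` lie in `m`, so `D w = 0`, and their initial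
    -- forms have positive degree, hence vanish in `A / A₊`.
    | succ j =>
      have hw (l) : (w l : R) ∈ IsLocalRing.maximalIdeal R :=
        Ideal.pow_le_self j.succ_ne_zero (w l).2
      refine iff_of_true ?_ ?_
      · rw [hD, (IsLocalRing.residue_eq_zero_iff _).2
          (Ideal.sum_mem _ fun l _ => Ideal.mul_mem_right _ _ (hw l))]
        exact zero_mem _
      · rw [d.apply_eq_sum_single]
        refine Finset.sum_eq_zero fun l _ => ?_
        rw [← hx]
        change Ideal.Quotient.mk J (σ (j + 1) (w l)) * Ideal.Quotient.mk J (σ 0 (x l)) = 0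
        rw [Ideal.Quotient.eq_zero_iff_mem.2 (mem_irrelevant_of_mem j.succ_ne_zero (hσ.mem _)),
          zero_mul]

end ModuleCase

theorem mainTheorem4 {R : Type u} [CommRing R] [IsLocalRing R] [IsNoetherianRing R] :
    (∀ (M : Type v) [AddCommGroup M] [Module R M] [Module.Finite R M],
      HasLinearResolution
          (A := AssocGradedRing (IsLocalRing.maximalIdeal R))
          (M := AssocGradedModule (IsLocalRing.maximalIdeal R) M)
          (assocGradedRingGrading (IsLocalRing.maximalIdeal R))
          (assocGradedModuleGrading (IsLocalRing.maximalIdeal R) M) →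
        (poincareSeries R M).IsRational) ∧
    (IsKoszul (A := AssocGradedRing (IsLocalRing.maximalIdeal R))
        (assocGradedRingGrading (IsLocalRing.maximalIdeal R)) →
      (poincareSeries R (IsLocalRing.ResidueField R)).IsRational) := by
  have hσ := isInitialForm_initialForm (IsLocalRing.maximalIdeal R)
  refine ⟨?_, ?_⟩
  · rintro M _ _ _ ⟨F, δ₀, hF⟩
    obtain ⟨D, hD⟩ := exists_isLift_of_isModuleInitialForm hσ
      (isModuleInitialForm_moduleInitialForm (IsLocalRing.maximalIdeal R) M) F.aug_surjective
      (F.aug_single_mem hF)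
    exact isRational_poincareSeries_of_isLift hσ F.toMinimalFreeResolution (F.d_single_mem hF) hD
  · rintro ⟨F, δ₀, hF⟩
    obtain ⟨D, hD⟩ := exists_isLift_residueField hσ F.aug_surjective
    exact isRational_poincareSeries_of_isLift hσ F.toMinimalFreeResolution (F.d_single_mem hF) hD
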